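/- A \emph{soccer tiling} is a cell structure on the $2$-sphere that is dual to a (simplicial) triangulation of the $2$-sphere in which every vertex has degree $5$ or $6$ and no two vertices of degree $5$ are joined by an edge; thus its $2$-cells are pentagons and hexagons, every vertex has degree $3$, and no two pentagons share a side. A \emph{soccer diagram} $D$ is a subcomplex of a soccer tiling that is homeomorphic to a disc; $|\partial D|$ denotes the number of edges of its boundary cycle. Traverse the boundary cycle counterclockwise. A boundary vertex is a left turn if it has degree $2$ in $D$ and a right turn if it has degree $3$ in $D$. The cyclic sequence of these turns is the \emph{turn pattern} of $D$, and $D$ has an \emph{exposed path of length $i$} if its turn pattern contains $i-1$ consecutive left turns (so that $\partial D$ and the boundary of some $2$-cell of $D$ share a path of length $i$). \textbf{Theorem.} Let $D$ be a soccer diagram with $|\partial D|\le 14$, with at most six pentagons, and with no exposed path of length $4$. Then $D$ is isomorphic, as a disc diagram (that is, by an isomorphism of cell complexes that preserves the orientation), to one of the following two diagrams: (a) the diagram with boundary length $12$ that consists of two hexagons sharing a side and two pentagons, one at either end of this side, each sharing a side with both hexagons; (b) the diagram with boundary length $14$ that consists of a hexagon $C$ and four $2$-cells $A,B,B',A'$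 that share, in this order, four consecutive sides with $C$, where $A,A'$ are pentagons, $B,B'$ are hexagons, and $A,B$ share a side, $B,B'$ share a side, and $B',A'$ share a side. -/

import Mathlib

/-- A cell structure on a closed oriented surface, encoded as a combinatorial map (rotation system).
The darts are the oriented edges. `face d` is the dart that follows `d` in the counterclockwise
traversal of the boundary of the `2`-cell on the left of `d`; `edge d` is `d` reversed. -/
structure CombMap (D : Type*) where
  edge : Equiv.Perm D
  face : Equiv.Perm D
  edge_edge : ∀ d, edge (edge d) = d
  edge_ne : ∀ d, edge d ≠ d

namespace CombMap

variable {D : Type*} (E : CombMap D)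

/-- Rotation about the starting point of a dart: `edge d` ends where `d` starts, so the dart that
follows `edge d` around its `2`-cell starts where `d` starts. -/
def vertex : Equiv.Perm D := E.face * E.edge

/-- The `0`-cells. -/
def Vertex : Type _ := Quotient (Equiv.Perm.SameCycle.setoid E.vertex)

/-- The `1`-cells. -/
def Edge : Type _ := Quotient (Equiv.Perm.SameCycle.setoid E.edge)

/-- The `2`-cells. -/
def Face : Type _ := Quotient (Equiv.Perm.SameCycle.setoid E.face)

/-- The starting point of a dart. -/
def vertexOf (d : D) : E.Vertex := Quotient.mk (Equiv.Perm.SameCycle.setoid E.vertex) d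

/-- The unoriented edge underlying a dart. -/
def edgeOf (d : D) : E.Edge := Quotient.mk (Equiv.Perm.SameCycle.setoid E.edge) d

/-- The `2`-cell on the left of a dart. -/
def faceOf (d : D) : E.Face := Quotient.mk (Equiv.Perm.SameCycle.setoid E.face) d

/-- The degree of a vertex (a loop would count twice). -/
noncomputable def vertexDegree (v : E.Vertex) : ℕ := {d | E.vertexOf d = v}.ncard

/-- The number of sides of a `2`-cell. -/
noncomputable def faceLength (f : E.Face) : ℕ := {d | E.faceOf d = f}.ncard

/-- Two `2`-cells share a side. -/
def FaceAdj (f g : E.Face) : Prop := ∃ d, E.faceOf d = f ∧ E.faceOf (E.edge d) = g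

/-- A `2`-cell contains a vertex. -/
def Incident (f : E.Face) (v : E.Vertex) : Prop := ∃ d, E.faceOf d = f ∧ E.vertexOf d = v

/-- The surface is connected. -/
def IsConnected : Prop :=
  ∀ d d' : D, ∃ g ∈ Subgroup.closure {E.edge, E.face}, g d = d'

/-- A combinatorial map (with finitely many darts) is a cell structure on the `2`-sphere: the
surface is connected with Euler characteristic `2`. -/
def IsSphere : Prop :=
  E.IsConnected ∧
    (Nat.card E.Vertex : ℤ) - (Nat.card E.Edge : ℤ) + (Nat.card E.Face : ℤ) = 2

/-- The dual cellulation is simplicial: its edges have two distinct endpoints, distinct edges have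
different sets of endpoints, and distinct triangles have different sets of corners. -/
def HasSimplicialDual : Prop :=
  (∀ d, E.faceOf d ≠ E.faceOf (E.edge d)) ∧
  (∀ d d', E.faceOf d = E.faceOf d' → E.faceOf (E.edge d) = E.faceOf (E.edge d') → d = d') ∧
  (∀ v w : E.Vertex, (∀ f, E.Incident f v ↔ E.Incident f w) → v = w)

/-- A soccer tiling of the `2`-sphere: the cell structure dual to a triangulation of the `2`-sphere
in which all vertices have degree `5` or `6` and no two vertices of degree `5` are joined by an
edge. -/
structure IsSoccerTiling : Prop where
  isSphere : E.IsSphere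
  vertexDegree_eq : ∀ v, E.vertexDegree v = 3
  hasSimplicialDual : E.HasSimplicialDual
  faceLength_eq : ∀ f, E.faceLength f = 5 ∨ E.faceLength f = 6
  not_adj : ∀ f g, E.faceLength f = 5 → E.faceLength g = 5 → ¬ E.FaceAdj f g

/-! A subcomplex homeomorphic to a disc is the union of its closed `2`-cells, so it is given by a
set `S` of `2`-cells. -/

/-- The Euler characteristic of the subcomplex formed by the closed `2`-cells in `S`. -/
noncomputable def eulerChar (S : Set E.Face) : ℤ :=
  ({v | ∃ d, E.faceOf d ∈ S ∧ E.vertexOf d = v}.ncard : ℤ)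
    - ({e | ∃ d, E.faceOf d ∈ S ∧ E.edgeOf d = e}.ncard : ℤ) + (S.ncard : ℤ)

/-- The union of the closed `2`-cells in `S` is a disc, for a tiling in which all vertices have
degree `3`. Any two of the corners at a vertex of degree `3` share an edge at that vertex. Hence the
link of each vertex in the union is an arc or a circle, so the union is a compact surface with
(possibly empty) boundary, and it is connected exactly if any two members of `S` are joined by a
chain of members of `S` that share sides. A compact connected surface in the sphere is a disc if and
only if its Euler characteristic is `1`. -/
def IsDisc (S : Set E.Face) : Prop :=
  S.Nonempty ∧
  (∀ f ∈ S, ∀ g ∈ S, Relation.ReflTransGen (fun a b => b ∈ S ∧ E.FaceAdj a b) f g) ∧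
  E.eulerChar S = 1

/-- A soccer diagram is a subcomplex of a soccer tiling that is homeomorphic to a disc. -/
def IsSoccerDiagram (S : Set E.Face) : Prop := E.IsSoccerTiling ∧ E.IsDisc S

/-- The darts of the counterclockwise boundary cycle: the diagram is on the left only. -/
def IsBoundaryDart (S : Set E.Face) (d : D) : Prop :=
  E.faceOf d ∈ S ∧ E.faceOf (E.edge d) ∉ S

/-- The length of the boundary cycle. -/
noncomputable def boundaryLength (S : Set E.Face) : ℕ := {d | E.IsBoundaryDart S d}.ncard

/-- The number of pentagons in the diagram. -/
noncomputable def numPentagons (S : Set E.Face) : ℕ := {f | f ∈ S ∧ E.faceLength f = 5}.ncard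

/-- A turn of the boundary cycle. -/
inductive Turn
  | left
  | right

open Classical in
/-- The turn made by the boundary cycle at the end of the boundary dart `d`: it is a left turn if
the cycle continues along the `2`-cell on the left of `d`. -/
noncomputable def turn (S : Set E.Face) (d : D) : Turn :=
  if E.IsBoundaryDart S (E.face d) then Turn.left else Turn.right

/-- The dart following `d` in the counterclockwise boundary cycle, in a tiling in which all vertices
have degree `3`. -/
noncomputable def nextBoundary (S : Set E.Face) (d : D) : D :=
  match E.turn S d with
  | Turn.left => E.face d
  | Turn.right => E.face (E.edge (E.face d))

/-- The turn pattern, read cyclically from the boundary dart `d`. -/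
noncomputable def turnPattern (S : Set E.Face) (d : D) (j : ℕ) : Turn :=
  E.turn S ((E.nextBoundary S)^[j] d)

/-- The diagram has an exposed path of length `i`: its turn pattern contains `i - 1` consecutive
left turns. -/
def HasExposedPath (S : Set E.Face) (i : ℕ) : Prop :=
  ∃ d, E.IsBoundaryDart S d ∧ ∀ j, j + 1 < i → E.turnPattern S d j = Turn.left

end CombMap

/-- A diagram presented as a collection of oriented polygons with some pairs of sides glued
(reversing orientation): `next` sends a side of a polygon to the counterclockwise following one. -/
structure PolygonGluing where
  Side : Type*
  next : Equiv.Perm Side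
  glue : Side → Side → Prop

/-- Isomorphism of diagrams (preserving the orientation). -/
def PolygonGluing.Iso (P : PolygonGluing) (Q : PolygonGluing) : Prop :=
  ∃ e : P.Side ≃ Q.Side, (∀ a, e (P.next a) = Q.next (e a)) ∧
    ∀ a b, P.glue a b ↔ Q.glue (e a) (e b)

/-- The diagram formed by the `2`-cells in `S`. -/
def CombMap.diagram {D : Type*} (E : CombMap D) (S : Set E.Face) : PolygonGluing where
  Side := {d : D // E.faceOf d ∈ S}
  next := E.face.subtypePerm (fun d => by
    have h : E.faceOf (E.face d) = E.faceOf d :=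
      Quotient.sound (s := Equiv.Perm.SameCycle.setoid E.face)
        (Equiv.Perm.sameCycle_apply_left.mpr (Equiv.Perm.SameCycle.refl E.face d))
    rw [h])
  glue a b := E.edge a.1 = b.1

/-- The polygons `0, …, k - 1`, where polygon `c` has `len c` sides, numbered `0, …, len c - 1`
counterclockwise; an entry `((c, s), (c', s'))` of the list means that side `s` of polygon `c` is
glued to side `s'` of polygon `c'`. -/
def PolygonGluing.ofList {k : ℕ} (len : Fin k → ℕ) (l : List ((ℕ × ℕ) × (ℕ × ℕ))) :
    PolygonGluing where
  Side := Σ c : Fin k, Fin (len c)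
  next := Equiv.sigmaCongrRight (fun c => finRotate (len c))
  glue a b :=
    (((a.1 : ℕ), (a.2 : ℕ)), ((b.1 : ℕ), (b.2 : ℕ))) ∈ l ∨
      (((b.1 : ℕ), (b.2 : ℕ)), ((a.1 : ℕ), (a.2 : ℕ))) ∈ l

/-- Two hexagons (`0`, `1`) sharing a side, and two pentagons (`2`, `3`), each sharing a side with
both hexagons, one at either end of the common side of the hexagons. The boundary has length
`12`. -/
def diagramTwelve : PolygonGluing :=
  PolygonGluing.ofList ![6, 6, 5, 5]
    [((0, 1), (1, 1)), ((0, 0), (2, 1)), ((1, 2), (2, 0)), ((0, 2), (3, 0)), ((1, 0), (3, 1))]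

/-- A hexagon (`0`) four consecutive sides of which are shared, in this order, with a pentagon
(`1`), a hexagon (`2`), a hexagon (`3`) and a pentagon (`4`); consecutive ones among these four
share a side as well. The boundary has length `14`. -/
def diagramFourteen : PolygonGluing :=
  PolygonGluing.ofList ![6, 5, 6, 6, 5]
    [((0, 0), (1, 1)), ((0, 1), (2, 1)), ((0, 2), (3, 1)), ((0, 3), (4, 0)),
      ((1, 0), (2, 2)), ((2, 0), (3, 2)), ((3, 0), (4, 1))]

/-!
For a set `T` of `2`-cells of a soccer tiling, let `n` be the number of boundary darts of the union of
its closed `2`-cells, `l` and `r` the numbers of left and right turns, and `p` the number of pentagons.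
Counting darts gives `n = l + r` and the Gauss–Bonnet formula `l - r + p = 6 χ`
(`CombMap.six_mul_eulerChar`).

*Planarity.* If the complement of a nonempty `T` is nonempty and connected through sides, then `χ ≥ 1`
(`CombMap.one_le_eulerChar`). This is a tree–cotree argument. The complement of a disc is connected
(`CombMap.IsDisc.sideConnected_compl`), and the condition is inherited when a `2`-cell with an exposed
side is removed from `T`, and when `T` is replaced by the set `CombMap.deep T` of its members without
exposed sides.

*Isoperimetry.* If `p ≤ 6` and the complement of `T` is connected, then `n ≥ 15` if `p ≥ 3`, and there
are weaker bounds for smaller `p` (`CombMap.isoperimetricBounds`). The proof is by induction on the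
number of `2`-cells. In a minimal counterexample, no `2`-cell with many exposed sides can be removed, so
there are few left turns, against Gauss–Bonnet. The most delicate case is `p = 6`, `l = r`, in which
the boundary of `deep T` is not longer than that of `T` (`CombMap.boundaryLength_deep_add_le`), while
at most three pentagons have exposed sides, since at most one of the two `2`-cells at a right turn is a
pentagon (`CombMap.two_mul_pentagonArcs_le`). So `deep T` would be a smaller counterexample.

*Conclusion.* For the diagram of the theorem, isoperimetry gives `p ≤ 2`. Arcs of exposed sides have
length at most `3`, so `l ≤ 2 r`, which leaves `p = 2` and `n = 2 r + 4` with `r = 4` or `r = 5`. The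
comparison with `deep S` shows that every `2`-cell has exposed sides, and then counting shows that each
has exactly one arc of them (`CombMap.shape`). So there are four or five `2`-cells, and the simpliciality
of the dual and the separation of the pentagons determine the gluing.
-/

/-! ### Sums over the cycles of a permutation -/

section Cycles

open Function

variable {α : Type*} [Finite α] (σ : Equiv.Perm α)

lemma sameCycle_iff_exists_iterate (x y : α) :
    σ.SameCycle x y ↔ ∃ i < minimalPeriod σ x, σ^[i] x = y := by
  have hx : x ∈ periodicPts σ := σ.injective.mem_periodicPts x
  constructor
  · intro h
    obtain ⟨i, hi⟩ := h.exists_nat_pow_eq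
    refine ⟨i % minimalPeriod σ x, Nat.mod_lt _ (minimalPeriod_pos_of_mem_periodicPts hx), ?_⟩
    rw [iterate_mod_minimalPeriod_eq, ← Equiv.Perm.coe_pow, hi]
  · rintro ⟨i, -, rfl⟩
    rw [← Equiv.Perm.coe_pow]
    exact ⟨i, by simp⟩

lemma ncard_sameCycle (x : α) : {y | σ.SameCycle x y}.ncard = minimalPeriod σ x := by
  have : {y | σ.SameCycle x y} = (fun i => σ^[i] x) '' Set.Iio (minimalPeriod σ x) := by
    ext y
    simp [sameCycle_iff_exists_iterate]
  rw [this, iterate_injOn_Iio_minimalPeriod.ncard_image]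
  rw [← Finset.coe_Iio, Set.ncard_coe_finset, Nat.card_Iio]

lemma iterate_ncard_sameCycle (x : α) : σ^[{y | σ.SameCycle x y}.ncard] x = x := by
  rw [ncard_sameCycle, iterate_minimalPeriod]

open scoped Classical in
lemma sum_sameCycle {M : Type*} [AddCommMonoid M] [Fintype α] (x : α) (g : α → M) :
    ∑ y with σ.SameCycle x y, g y
      = ∑ i ∈ Finset.range {y | σ.SameCycle x y}.ncard, g (σ^[i] x) := by
  rw [ncard_sameCycle]
  symm
  refine Finset.sum_bij (fun i _ => σ^[i] x) ?_ ?_ ?_ ?_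
  · intro i hi
    simpa [sameCycle_iff_exists_iterate] using ⟨i, by simpa using hi, rfl⟩
  · intro i hi j hj h
    exact iterate_injOn_Iio_minimalPeriod (by simpa using hi) (by simpa using hj) h
  · intro y hy
    simpa [sameCycle_iff_exists_iterate] using hy
  · intros; rfl

end Cycles

namespace CombMap

/-! ### Darts, faces and vertices -/

section Basic

variable {D : Type*} (E : CombMap D)

lemma faceOf_eq_iff {d d' : D} : E.faceOf d = E.faceOf d' ↔ E.face.SameCycle d d' :=
  Quotient.eq (r := Equiv.Perm.SameCycle.setoid E.face)

lemma vertexOf_eq_iff {d d' : D} : E.vertexOf d = E.vertexOf d' ↔ E.vertex.SameCycle d d' :=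
  Quotient.eq (r := Equiv.Perm.SameCycle.setoid E.vertex)

lemma edgeOf_eq_iff {d d' : D} : E.edgeOf d = E.edgeOf d' ↔ E.edge.SameCycle d d' :=
  Quotient.eq (r := Equiv.Perm.SameCycle.setoid E.edge)

lemma exists_faceOf_eq (f : E.Face) : ∃ d, E.faceOf d = f := Quotient.exists_rep f

lemma exists_vertexOf_eq (v : E.Vertex) : ∃ d, E.vertexOf d = v := Quotient.exists_rep v

lemma exists_edgeOf_eq (e : E.Edge) : ∃ d, E.edgeOf d = e := Quotient.exists_rep e

@[simp] lemma faceOf_face (d : D) : E.faceOf (E.face d) = E.faceOf d :=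
  E.faceOf_eq_iff.2 (Equiv.Perm.sameCycle_apply_left.2 (Equiv.Perm.SameCycle.refl _ _))

@[simp] lemma faceOf_iterate (i : ℕ) (d : D) : E.faceOf (E.face^[i] d) = E.faceOf d := by
  induction i generalizing d with
  | zero => rfl
  | succ i ih => rw [Function.iterate_succ_apply, ih, faceOf_face]

@[simp] lemma faceOf_face_symm (d : D) : E.faceOf (E.face.symm d) = E.faceOf d := by
  rw [← E.faceOf_face (E.face.symm d), Equiv.apply_symm_apply]

@[simp] lemma vertexOf_vertex (d : D) : E.vertexOf (E.vertex d) = E.vertexOf d :=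
  E.vertexOf_eq_iff.2 (Equiv.Perm.sameCycle_apply_left.2 (Equiv.Perm.SameCycle.refl _ _))

@[simp] lemma edgeOf_edge (d : D) : E.edgeOf (E.edge d) = E.edgeOf d :=
  E.edgeOf_eq_iff.2 (Equiv.Perm.sameCycle_apply_left.2 (Equiv.Perm.SameCycle.refl _ _))

@[simp] lemma edge_edge_apply (d : D) : E.edge (E.edge d) = d := E.edge_edge d

lemma vertex_apply (d : D) : E.vertex d = E.face (E.edge d) := rfl

@[simp] lemma vertex_edge (d : D) : E.vertex (E.edge d) = E.face d := by simp [vertex_apply]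

/-- The end of a dart is the starting point of the dart that follows it. -/
lemma vertexOf_edge (d : D) : E.vertexOf (E.edge d) = E.vertexOf (E.face d) := by
  rw [← E.vertexOf_vertex (E.edge d), vertex_edge]

@[simp] lemma faceOf_vertex (d : D) : E.faceOf (E.vertex d) = E.faceOf (E.edge d) := by
  simp [vertex_apply]

lemma faceAdj_symm {f g : E.Face} (h : E.FaceAdj f g) : E.FaceAdj g f := by
  obtain ⟨d, rfl, rfl⟩ := h
  exact ⟨E.edge d, rfl, by simp⟩

lemma edgeOf_eq_iff' {d d' : D} : E.edgeOf d = E.edgeOf d' ↔ d' = d ∨ d' = E.edge d := by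
  rw [edgeOf_eq_iff]
  constructor
  · rintro ⟨i, rfl⟩
    obtain ⟨j, rfl | rfl⟩ := Int.even_or_odd' i
    · left
      rw [zpow_mul]
      have : E.edge ^ (2 : ℤ) = 1 := by
        ext d; simp [zpow_ofNat, pow_two]
      simp [this]
    · right
      rw [zpow_add, zpow_mul]
      have : E.edge ^ (2 : ℤ) = 1 := by
        ext d; simp [zpow_ofNat, pow_two]
      simp [this]
  · rintro (rfl | rfl)
    · exact Equiv.Perm.SameCycle.refl _ _
    · exact Equiv.Perm.sameCycle_apply_right.2 (Equiv.Perm.SameCycle.refl _ _)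

instance [Finite D] : Finite E.Face := Quotient.finite _
instance [Finite D] : Finite E.Edge := Quotient.finite _
instance [Finite D] : Finite E.Vertex := Quotient.finite _

noncomputable instance [Finite D] : Fintype E.Face := Fintype.ofFinite _
noncomputable instance [Finite D] : Fintype E.Edge := Fintype.ofFinite _
noncomputable instance [Finite D] : Fintype E.Vertex := Fintype.ofFinite _

lemma faceLength_faceOf (d : D) :
    E.faceLength (E.faceOf d) = {y | E.face.SameCycle d y}.ncard := by
  unfold faceLength
  congr 1
  ext y
  simp [faceOf_eq_iff, Equiv.Perm.sameCycle_comm (x := y)]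

lemma vertexDegree_vertexOf (d : D) :
    E.vertexDegree (E.vertexOf d) = {y | E.vertex.SameCycle d y}.ncard := by
  unfold vertexDegree
  congr 1
  ext y
  simp [vertexOf_eq_iff, Equiv.Perm.sameCycle_comm (x := y)]

lemma iterate_faceLength [Finite D] (d : D) :
    E.face^[E.faceLength (E.faceOf d)] d = d := by
  rw [faceLength_faceOf, iterate_ncard_sameCycle]

lemma exists_iterate_of_faceOf_eq [Finite D] {d d' : D} (h : E.faceOf d' = E.faceOf d) :
    ∃ i < E.faceLength (E.faceOf d), E.face^[i] d = d' := by
  rw [faceLength_faceOf, ncard_sameCycle]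
  exact (sameCycle_iff_exists_iterate _ _ _).1 (E.faceOf_eq_iff.1 h.symm)

lemma iterate_face_inj [Finite D] {d : D} {i j : ℕ} (hi : i < E.faceLength (E.faceOf d))
    (hj : j < E.faceLength (E.faceOf d)) (h : E.face^[i] d = E.face^[j] d) : i = j := by
  rw [faceLength_faceOf, ncard_sameCycle] at hi hj
  exact Function.iterate_injOn_Iio_minimalPeriod hi hj h

/-- At a vertex of degree `3`, the rotation has order `3`. -/
lemma vertex_vertex_vertex [Finite D] (h3 : ∀ v, E.vertexDegree v = 3) (d : D) :
    E.vertex (E.vertex (E.vertex d)) = d := by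
  have := iterate_ncard_sameCycle E.vertex d
  rwa [← vertexDegree_vertexOf, h3] at this

/-- Two consecutive sides of a `2`-cell and the third edge at their common vertex. -/
lemma face_edge_face [Finite D] (h3 : ∀ v, E.vertexDegree v = 3) (d : D) :
    E.edge (E.face (E.edge (E.face d))) = E.face.symm (E.edge d) := by
  have := E.vertex_vertex_vertex h3 (E.edge d)
  rw [vertex_edge] at this
  simp only [vertex_apply] at this
  rw [← this, Equiv.symm_apply_apply]

open scoped Classical in
/-- The sum of a function of darts over the sides of a `2`-cell. -/
noncomputable def sideSum [Fintype D] (f : E.Face) (g : D → ℕ) : ℕ :=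
  ∑ d with E.faceOf d = f, g d

lemma sum_sideSum [Fintype D] (g : D → ℕ) : ∑ f, E.sideSum f g = ∑ d, g d := by
  classical
  unfold sideSum
  exact Finset.sum_fiberwise Finset.univ E.faceOf g

lemma sideSum_faceOf [Fintype D] (d : D) (g : D → ℕ) :
    E.sideSum (E.faceOf d) g
      = ∑ i ∈ Finset.range (E.faceLength (E.faceOf d)), g (E.face^[i] d) := by
  classical
  rw [faceLength_faceOf, ← sum_sameCycle]
  unfold sideSum
  congr 1
  ext y
  simp [faceOf_eq_iff, Equiv.Perm.sameCycle_comm (x := y)]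

lemma sideSum_one [Fintype D] (f : E.Face) : E.sideSum f (fun _ => 1) = E.faceLength f := by
  obtain ⟨d, rfl⟩ := E.exists_faceOf_eq f
  simp [sideSum_faceOf]

lemma sideSum_congr [Fintype D] {f : E.Face} {g h : D → ℕ}
    (H : ∀ d, E.faceOf d = f → g d = h d) : E.sideSum f g = E.sideSum f h := by
  classical
  exact Finset.sum_congr rfl fun d hd => H d (by simpa using hd)

lemma sideSum_le [Fintype D] {f : E.Face} {g h : D → ℕ}
    (H : ∀ d, E.faceOf d = f → g d ≤ h d) : E.sideSum f g ≤ E.sideSum f h := by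
  classical
  exact Finset.sum_le_sum fun d hd => H d (by simpa using hd)

lemma sideSum_eq_zero [Fintype D] {f : E.Face} {g : D → ℕ}
    (H : ∀ d, E.faceOf d = f → g d = 0) : E.sideSum f g = 0 := by
  classical
  exact Finset.sum_eq_zero fun d hd => H d (by simpa using hd)

lemma sideSum_pos [Fintype D] {g : D → ℕ} {d : D} (H : 0 < g d) :
    0 < E.sideSum (E.faceOf d) g := by
  classical
  exact Finset.sum_pos' (fun _ _ => Nat.zero_le _) ⟨d, by simp, H⟩

end Basic

end CombMap

namespace CombMap

/-! ### Combinatorial Gauss–Bonnet -/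

section Counting

open scoped Classical

variable {D : Type*} (E : CombMap D)

/-- Whether the `2`-cell on the left of a dart belongs to `T`. -/
noncomputable def inside (T : Set E.Face) (d : D) : Bool := decide (E.faceOf d ∈ T)

/-- Whether a dart is an exposed side of a `2`-cell in `T`, that is, a boundary dart. -/
noncomputable def exposed (T : Set E.Face) (d : D) : Bool := decide (E.IsBoundaryDart T d)

lemma inside_eq_true {T : Set E.Face} {d : D} : E.inside T d = true ↔ E.faceOf d ∈ T := by
  simp [inside]

lemma exposed_eq_true {T : Set E.Face} {d : D} :
    E.exposed T d = true ↔ E.faceOf d ∈ T ∧ E.faceOf (E.edge d) ∉ T := by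
  rw [exposed, decide_eq_true_iff, IsBoundaryDart]

lemma exposed_eq_false {T : Set E.Face} {d : D} (hd : E.faceOf d ∈ T) :
    E.exposed T d = false ↔ E.faceOf (E.edge d) ∈ T := by
  rw [← Bool.not_eq_true, exposed_eq_true]
  tauto

lemma exposed_eq (T : Set E.Face) (d : D) :
    E.exposed T d = (E.inside T d && !E.inside T (E.edge d)) := by
  rw [Bool.eq_iff_iff]
  simp [exposed_eq_true, inside]

lemma inside_face (T : Set E.Face) (d : D) : E.inside T (E.face d) = E.inside T d := by
  simp [inside]

lemma inside_edge (T : Set E.Face) (d : D) : E.inside T (E.edge d) = E.inside T (E.vertex d) := by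
  simp [inside]

variable [Fintype D]

/-- The number of left turns of the boundary of the union of the `2`-cells in `T`. -/
noncomputable def lefts (T : Set E.Face) : ℕ :=
  ∑ d, (E.exposed T d && E.exposed T (E.face d)).toNat

/-- The number of right turns of the boundary of the union of the `2`-cells in `T`. -/
noncomputable def rights (T : Set E.Face) : ℕ :=
  ∑ d, (E.exposed T d && !E.exposed T (E.face d)).toNat

lemma ncard_eq_sum {α : Type*} [Fintype α] (P : α → Prop) [DecidablePred P] :
    {a | P a}.ncard = ∑ a, (decide (P a)).toNat := by
  rw [Set.ncard_eq_toFinset_card', Set.toFinset_ofPred, Finset.card_filter]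
  refine Finset.sum_congr rfl fun a _ => ?_
  by_cases h : P a <;> simp [h]

lemma boundaryLength_eq_sum (T : Set E.Face) :
    E.boundaryLength T = ∑ d, (E.exposed T d).toNat :=
  ncard_eq_sum _

lemma numPentagons_eq_sum (T : Set E.Face) :
    E.numPentagons T = ∑ f, (decide (f ∈ T ∧ E.faceLength f = 5)).toNat :=
  ncard_eq_sum _

lemma ncard_faces_eq_sum (T : Set E.Face) : T.ncard = ∑ f, (decide (f ∈ T)).toNat :=
  ncard_eq_sum (· ∈ T)

lemma lefts_add_rights (T : Set E.Face) : E.lefts T + E.rights T = E.boundaryLength T := by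
  rw [boundaryLength_eq_sum, lefts, rights, ← Finset.sum_add_distrib]
  refine Finset.sum_congr rfl fun d _ => ?_
  cases E.exposed T d <;> cases E.exposed T (E.face d) <;> rfl

/-- The number of darts whose `2`-cell is in `T`. -/
noncomputable def corners₁ (T : Set E.Face) : ℤ := ∑ d, ((E.inside T d).toNat : ℤ)

/-- The number of darts such that the `2`-cells on either side are in `T`. -/
noncomputable def corners₂ (T : Set E.Face) : ℤ :=
  ∑ d, ((E.inside T d && E.inside T (E.vertex d)).toNat : ℤ)

/-- The number of darts such that all `2`-cells at the starting point are in `T`. -/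
noncomputable def corners₃ (T : Set E.Face) : ℤ :=
  ∑ d, ((E.inside T d && E.inside T (E.vertex d) &&
    E.inside T (E.vertex (E.vertex d))).toNat : ℤ)

lemma sum_vertex (g : D → ℤ) : ∑ d, g (E.vertex d) = ∑ d, g d := Equiv.sum_comp E.vertex g

lemma sum_edge (g : D → ℤ) : ∑ d, g (E.edge d) = ∑ d, g d := Equiv.sum_comp E.edge g

lemma boundaryLength_eq_corners (T : Set E.Face) :
    (E.boundaryLength T : ℤ) = E.corners₁ T - E.corners₂ T := by
  rw [boundaryLength_eq_sum, corners₁, corners₂, ← Finset.sum_sub_distrib]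
  push_cast
  refine Finset.sum_congr rfl fun d _ => ?_
  rw [exposed_eq, inside_edge]
  cases E.inside T d <;> cases E.inside T (E.vertex d) <;> simp

variable {E}

lemma corners₂_eq (h3 : ∀ v, E.vertexDegree v = 3) (T : Set E.Face) :
    E.corners₂ T = ∑ d, ((E.inside T d && E.inside T (E.vertex (E.vertex d))).toNat : ℤ) := by
  rw [corners₂, ← E.sum_vertex, ← E.sum_vertex]
  refine Finset.sum_congr rfl fun d _ => ?_
  rw [E.vertex_vertex_vertex h3, Bool.and_comm]

lemma rights_eq_corners (h3 : ∀ v, E.vertexDegree v = 3) (T : Set E.Face) :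
    (E.rights T : ℤ) = E.corners₂ T - E.corners₃ T := by
  rw [rights, corners₂, corners₃, ← E.sum_vertex, ← E.sum_vertex (g := fun d => ((E.inside T d &&
    E.inside T (E.vertex d) && E.inside T (E.vertex (E.vertex d))).toNat : ℤ)),
    ← Finset.sum_sub_distrib]
  push_cast
  rw [← E.sum_edge]
  refine Finset.sum_congr rfl fun d _ => ?_
  rw [E.vertex_vertex_vertex h3, exposed_eq, exposed_eq, ← vertex_apply, inside_edge, inside_edge,
    inside_edge, vertex_edge, inside_face]
  have : E.inside T (E.edge d) = E.inside T (E.vertex d) := inside_edge E T d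
  cases E.inside T d <;> cases E.inside T (E.vertex d) <;>
    cases E.inside T (E.vertex (E.vertex d)) <;> simp_all

lemma lefts_eq_corners (h3 : ∀ v, E.vertexDegree v = 3) (T : Set E.Face) :
    (E.lefts T : ℤ) = E.corners₁ T - 2 * E.corners₂ T + E.corners₃ T := by
  have h1 := E.lefts_add_rights T
  have h2 := E.boundaryLength_eq_corners T
  have h3 := rights_eq_corners h3 T
  zify at h1
  linarith

lemma three_mul_ncard_vertex (h3 : ∀ v, E.vertexDegree v = 3) (P : E.Vertex → Prop) :
    3 * {v | P v}.ncard = ∑ d, (decide (P (E.vertexOf d))).toNat := by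
  rw [ncard_eq_sum, Finset.mul_sum, ← Finset.sum_fiberwise Finset.univ E.vertexOf]
  refine Finset.sum_congr rfl fun v _ => ?_
  rw [Finset.sum_congr rfl (g := fun _ => (decide (P v)).toNat)
    (fun d hd => by rw [(Finset.mem_filter.1 hd).2])]
  rw [Finset.sum_const, ← h3 v, vertexDegree, Set.ncard_eq_toFinset_card', Set.toFinset_ofPred]
  rfl

lemma two_mul_ncard_edge (P : E.Edge → Prop) :
    2 * {e | P e}.ncard = ∑ d, (decide (P (E.edgeOf d))).toNat := by
  rw [ncard_eq_sum, Finset.mul_sum, ← Finset.sum_fiberwise Finset.univ E.edgeOf]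
  refine Finset.sum_congr rfl fun e _ => ?_
  rw [Finset.sum_congr rfl (g := fun _ => (decide (P e)).toNat)
    (fun d hd => by rw [(Finset.mem_filter.1 hd).2])]
  obtain ⟨d, rfl⟩ := E.exists_edgeOf_eq e
  have : Finset.univ.filter (fun d' => E.edgeOf d' = E.edgeOf d) = {d, E.edge d} := by
    ext d'
    rw [Finset.mem_filter, eq_comm, edgeOf_eq_iff']
    simp
  rw [Finset.sum_const, this, Finset.card_pair (E.edge_ne d).symm]
  rfl

lemma sum_faceLength (T : Set E.Face) :
    (∑ f, (decide (f ∈ T)).toNat * E.faceLength f : ℕ) = E.corners₁ T := by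
  rw [corners₁, ← Nat.cast_sum, ← E.sum_sideSum]
  congr 1
  refine Finset.sum_congr rfl fun f _ => ?_
  rw [← sideSum_one, sideSum, sideSum, Finset.mul_sum]
  refine Finset.sum_congr rfl fun d hd => ?_
  rw [inside, (Finset.mem_filter.1 hd).2, mul_one]

lemma six_mul_ncard (h : ∀ f, E.faceLength f = 5 ∨ E.faceLength f = 6) (T : Set E.Face) :
    (6 * T.ncard : ℤ) = E.corners₁ T + E.numPentagons T := by
  rw [← sum_faceLength, numPentagons_eq_sum, ncard_faces_eq_sum, ← Nat.cast_add,
    ← Finset.sum_add_distrib]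
  push_cast
  rw [Finset.mul_sum]
  refine Finset.sum_congr rfl fun f _ => ?_
  by_cases hf : f ∈ T <;> rcases h f with h | h <;> simp [hf, h]

/-- The combinatorial Gauss–Bonnet formula. -/
theorem six_mul_eulerChar (hE : E.IsSoccerTiling) (T : Set E.Face) :
    6 * E.eulerChar T = E.lefts T - E.rights T + E.numPentagons T := by
  have hV : (3 * {v | ∃ d, E.faceOf d ∈ T ∧ E.vertexOf d = v}.ncard : ℤ)
      = 3 * E.corners₁ T - 3 * E.corners₂ T + E.corners₃ T := by
    have h := three_mul_ncard_vertex hE.vertexDegree_eq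
      (fun v => ∃ d, E.faceOf d ∈ T ∧ E.vertexOf d = v)
    zify at h
    rw [h]
    have h1 := corners₂_eq hE.vertexDegree_eq T
    have e1 : E.corners₁ T = ∑ d, ((E.inside T (E.vertex d)).toNat : ℤ) :=
      (E.sum_vertex _).symm
    have e2 : E.corners₁ T = ∑ d, ((E.inside T (E.vertex (E.vertex d))).toNat : ℤ) :=
      e1.trans (E.sum_vertex fun d => ((E.inside T (E.vertex d)).toNat : ℤ)).symm
    have e3 : E.corners₂ T
        = ∑ d, ((E.inside T (E.vertex d) && E.inside T (E.vertex (E.vertex d))).toNat : ℤ) :=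
      (E.sum_vertex _).symm
    have : 3 * E.corners₁ T - 3 * E.corners₂ T + E.corners₃ T
      = E.corners₁ T + E.corners₁ T + E.corners₁ T - E.corners₂ T - E.corners₂ T - E.corners₂ T
        + E.corners₃ T := by ring
    rw [this]
    nth_rw 3 [e2]
    nth_rw 2 [e1]
    nth_rw 3 [e3]
    nth_rw 2 [h1]
    simp only [corners₁, corners₂, corners₃, ← Finset.sum_add_distrib, ← Finset.sum_sub_distrib]
    refine Finset.sum_congr rfl fun d _ => ?_
    have hd : (∃ d', E.faceOf d' ∈ T ∧ E.vertexOf d' = E.vertexOf d) ↔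
        (E.inside T d = true ∨ E.inside T (E.vertex d) = true
          ∨ E.inside T (E.vertex (E.vertex d)) = true) := by
      simp only [inside_eq_true]
      constructor
      · rintro ⟨d', hd', h⟩
        rw [eq_comm, vertexOf_eq_iff, sameCycle_iff_exists_iterate, ← ncard_sameCycle,
          ← vertexDegree_vertexOf, hE.vertexDegree_eq] at h
        obtain ⟨i, hi, rfl⟩ := h
        interval_cases i
        · exact Or.inl hd'
        · exact Or.inr (Or.inl hd')
        · exact Or.inr (Or.inr hd')
      · rintro (h | h | h)
        exacts [⟨_, h, rfl⟩, ⟨_, h, by simp⟩, ⟨_, h, by simp⟩]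
    simp only [hd]
    cases E.inside T d <;> cases E.inside T (E.vertex d) <;>
      cases E.inside T (E.vertex (E.vertex d)) <;> simp
  have hEdge : (2 * {e | ∃ d, E.faceOf d ∈ T ∧ E.edgeOf d = e}.ncard : ℤ)
      = 2 * E.corners₁ T - E.corners₂ T := by
    have h := two_mul_ncard_edge (fun e => ∃ d, E.faceOf d ∈ T ∧ E.edgeOf d = e)
    zify at h
    rw [h]
    have e1 : E.corners₁ T = ∑ d, ((E.inside T (E.vertex d)).toNat : ℤ) :=
      (E.sum_vertex _).symm
    rw [two_mul]
    nth_rw 2 [e1]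
    simp only [corners₁, corners₂, ← Finset.sum_add_distrib, ← Finset.sum_sub_distrib]
    refine Finset.sum_congr rfl fun d _ => ?_
    have hd : (∃ d', E.faceOf d' ∈ T ∧ E.edgeOf d' = E.edgeOf d) ↔
        (E.inside T d = true ∨ E.inside T (E.vertex d) = true) := by
      simp only [inside_eq_true]
      constructor
      · rintro ⟨d', hd', h⟩
        rcases (E.edgeOf_eq_iff').1 h with rfl | rfl
        · exact Or.inl hd'
        · right; simpa using hd'
      · rintro (h | h)
        exacts [⟨_, h, rfl⟩, ⟨E.edge d, by simpa using h, by simp⟩]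
    simp only [hd]
    cases E.inside T d <;> cases E.inside T (E.vertex d) <;> simp
  have hF := six_mul_ncard hE.faceLength_eq T
  have hl := lefts_eq_corners hE.vertexDegree_eq T
  have hr := rights_eq_corners hE.vertexDegree_eq T
  rw [eulerChar]
  linarith

lemma eulerChar_univ {D : Type*} {E : CombMap D} (hE : E.IsSoccerTiling) :
    E.eulerChar Set.univ = 2 := by
  rw [← hE.isSphere.2, eulerChar]
  have h1 : {v | ∃ d, E.faceOf d ∈ Set.univ ∧ E.vertexOf d = v} = Set.univ := by
    ext v; simpa using E.exists_vertexOf_eq v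
  have h2 : {e | ∃ d, E.faceOf d ∈ Set.univ ∧ E.edgeOf d = e} = Set.univ := by
    ext v; simpa using E.exists_edgeOf_eq v
  rw [h1, h2, Set.ncard_univ, Set.ncard_univ, Set.ncard_univ]

lemma lefts_compl (hE : E.IsSoccerTiling) (T : Set E.Face) : E.lefts Tᶜ = E.rights T := by
  have h1 := lefts_eq_corners hE.vertexDegree_eq Tᶜ
  have h2 := rights_eq_corners hE.vertexDegree_eq T
  have e3 : E.corners₂ T
      = ∑ d, ((E.inside T (E.vertex d) && E.inside T (E.vertex (E.vertex d))).toNat : ℤ) :=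
    (E.sum_vertex _).symm
  have h3 := corners₂_eq hE.vertexDegree_eq Tᶜ
  zify
  rw [h1, h2, two_mul]
  nth_rw 1 [h3]
  rw [e3]
  simp only [corners₁, corners₂, corners₃, ← Finset.sum_add_distrib, ← Finset.sum_sub_distrib]
  refine Finset.sum_congr rfl fun d _ => ?_
  have hc : ∀ d, E.inside Tᶜ d = !E.inside T d := fun d => by
    rw [Bool.eq_iff_iff]; simp [inside]
  simp only [hc]
  cases E.inside T d <;> cases E.inside T (E.vertex d) <;>
    cases E.inside T (E.vertex (E.vertex d)) <;> simp

lemma numPentagons_union {A B : Set E.Face} (h : Disjoint A B) :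
    E.numPentagons (A ∪ B) = E.numPentagons A + E.numPentagons B := by
  simp only [numPentagons_eq_sum, ← Finset.sum_add_distrib]
  refine Finset.sum_congr rfl fun f _ => ?_
  have : f ∈ A → f ∉ B := fun h1 h2 => Set.disjoint_left.1 h h1 h2
  by_cases h1 : f ∈ A <;> by_cases h2 : f ∈ B <;> by_cases h3 : E.faceLength f = 5 <;> simp_all

lemma eulerChar_compl (hE : E.IsSoccerTiling) (T : Set E.Face) :
    E.eulerChar T + E.eulerChar Tᶜ = 2 := by
  have h1 := six_mul_eulerChar hE T
  have h2 := six_mul_eulerChar hE Tᶜ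
  have h3 := six_mul_eulerChar hE Set.univ
  have h4 := lefts_compl hE T
  have h5 := lefts_compl hE Tᶜ
  have h6 := lefts_compl hE Set.univ
  have h7 := numPentagons_union (disjoint_compl_right (a := T))
  rw [Set.union_compl_self] at h7
  rw [compl_compl] at h5
  have h8 : E.lefts Set.univ = 0 := by simp [lefts, exposed, IsBoundaryDart]
  have h9 : E.rights Set.univ = 0 := by simp [rights, exposed, IsBoundaryDart]
  have h0 := eulerChar_univ hE
  rw [h0, h8, h9, h7] at h3
  rw [h4] at h2
  rw [h5] at h1
  push_cast at *
  linarith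

/-- The Euler characteristic is additive on sets of `2`-cells that share no side. -/
lemma eulerChar_union (hE : E.IsSoccerTiling) {A B : Set E.Face} (h : Disjoint A B)
    (hAB : ∀ f ∈ A, ∀ g ∈ B, ¬ E.FaceAdj f g) :
    E.eulerChar (A ∪ B) = E.eulerChar A + E.eulerChar B := by
  have h1 := six_mul_eulerChar hE A
  have h2 := six_mul_eulerChar hE B
  have h3 := six_mul_eulerChar hE (A ∪ B)
  have hp := numPentagons_union h
  rw [lefts_eq_corners hE.vertexDegree_eq, rights_eq_corners hE.vertexDegree_eq] at h1 h2 h3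
  have hu : ∀ d, E.inside (A ∪ B) d = (E.inside A d || E.inside B d) := fun d => by
    rw [Bool.eq_iff_iff]; simp [inside]
  have h0 : ∀ d, (E.inside A d && E.inside B d) = false := fun d => by
    have := fun h1 : E.faceOf d ∈ A => Set.disjoint_left.1 h h1
    simpa [inside] using this
  have h01 : ∀ d, (E.inside A d && E.inside B (E.vertex d)) = false := fun d => by
    have := fun h1 h2 => hAB (E.faceOf d) h1 (E.faceOf (E.edge d)) h2 ⟨d, rfl, rfl⟩
    simpa [inside] using this
  have h10 : ∀ d, (E.inside A (E.vertex d) && E.inside B d) = false := fun d => by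
    have := fun h1 h2 => hAB (E.faceOf (E.edge d)) h1 (E.faceOf d) h2 ⟨E.edge d, rfl, by simp⟩
    simpa [inside] using this
  have e1 : E.corners₁ (A ∪ B) = E.corners₁ A + E.corners₁ B := by
    simp only [corners₁, ← Finset.sum_add_distrib]
    refine Finset.sum_congr rfl fun d _ => ?_
    have h0 := h0 d
    rw [hu]
    cases h1 : E.inside A d <;> cases h2 : E.inside B d <;> simp_all
  have e2 : E.corners₂ (A ∪ B) = E.corners₂ A + E.corners₂ B := by
    simp only [corners₂, ← Finset.sum_add_distrib]
    refine Finset.sum_congr rfl fun d _ => ?_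
    have h00 := h0 d
    have h11 := h0 (E.vertex d)
    have h01 := h01 d
    have h10 := h10 d
    rw [hu, hu]
    revert h00 h11 h01 h10
    cases E.inside A d <;> cases E.inside B d <;> cases E.inside A (E.vertex d) <;>
      cases E.inside B (E.vertex d) <;> simp
  have e3 : E.corners₃ (A ∪ B) = E.corners₃ A + E.corners₃ B := by
    simp only [corners₃, ← Finset.sum_add_distrib]
    refine Finset.sum_congr rfl fun d _ => ?_
    have h00 := h0 d
    have h11 := h0 (E.vertex d)
    have h22 := h0 (E.vertex (E.vertex d))
    have h01' := h01 (E.vertex d)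
    have h10' := h10 (E.vertex d)
    have h01 := h01 d
    have h10 := h10 d
    rw [hu, hu, hu]
    revert h00 h11 h22 h01 h10 h01' h10'
    cases E.inside A d <;> cases E.inside B d <;> cases E.inside A (E.vertex d) <;>
      cases E.inside B (E.vertex d) <;> cases E.inside A (E.vertex (E.vertex d)) <;>
      cases E.inside B (E.vertex (E.vertex d)) <;> simp
  rw [e1, e2, e3, hp] at h3
  push_cast at h3
  linarith

end Counting

end CombMap

/-! ### Connected sets of `2`-cells and planarity -/

/-- If every point is reached from a root along `r`, then there is a height function such that every
point other than a root has a predecessor of smaller height. -/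
lemma exists_height {α : Type*} (r : α → α → Prop) (P : α → Prop)
    (H : ∀ x, ∃ x₀, P x₀ ∧ Relation.ReflTransGen r x₀ x) :
    ∃ h : α → ℕ, ∀ x, ¬ P x → ∃ y, r y x ∧ h y < h x := by
  classical
  let Q : ℕ → α → Prop := fun n =>
    @Nat.rec (fun _ => α → Prop) P (fun _ q x => ∃ y, q y ∧ r y x) n
  have hQ : ∀ x, ∃ n, Q n x := by
    intro x
    obtain ⟨x₀, h0, h⟩ := H x
    induction h with
    | refl => exact ⟨0, h0⟩
    | tail _ hr ih =>
      obtain ⟨n, hn⟩ := ih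
      exact ⟨n + 1, _, hn, hr⟩
  refine ⟨fun x => Nat.find (hQ x), fun x hx => ?_⟩
  rcases hn : Nat.find (hQ x) with _ | n
  · exact absurd (show Q 0 x from hn ▸ Nat.find_spec (hQ x)) hx
  · obtain ⟨y, hy, hr⟩ : Q (n + 1) x := hn ▸ Nat.find_spec (hQ x)
    refine ⟨y, hr, ?_⟩
    simp only [hn]
    exact Nat.lt_succ_of_le (Nat.find_min' _ hy)

namespace CombMap

section Planarity

variable {D : Type*} {E : CombMap D}

variable (E) in
/-- A set of `2`-cells is connected through sides: it is not the union of two nonempty parts that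
share no side. -/
def SideConnected (U : Set E.Face) : Prop :=
  ∀ A ⊆ U, A.Nonempty → (U \ A).Nonempty → ∃ f ∈ A, ∃ g ∈ U \ A, E.FaceAdj f g

lemma sideConnected_of_reflTransGen {U : Set E.Face}
    (h : ∀ f ∈ U, ∀ g ∈ U, Relation.ReflTransGen (fun a b => b ∈ U ∧ E.FaceAdj a b) f g) :
    E.SideConnected U := by
  rintro A hA ⟨f, hf⟩ ⟨g, hgU, hgA⟩
  by_contra! hcon
  refine hgA ?_
  induction h f (hA hf) g hgU with
  | refl => exact hf
  | @tail b c hb hc ih =>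
    by_contra hcA
    by_cases hbA : b ∈ A
    · exact hcon b hbA c ⟨hc.1, hcA⟩ hc.2
    · exact hbA (ih (by
        rcases Relation.ReflTransGen.cases_tail hb with rfl | ⟨_, _, h⟩
        exacts [hA hf, h.1]) hbA)

lemma sideConnected_univ (hE : E.IsConnected) : E.SideConnected Set.univ := by
  rintro A - ⟨f, hf⟩ ⟨g, -, hg⟩
  by_contra! hcon
  obtain ⟨d, rfl⟩ := E.exists_faceOf_eq f
  obtain ⟨d', rfl⟩ := E.exists_faceOf_eq g
  obtain ⟨p, hp, rfl⟩ := hE d d'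
  have key : ∀ d, E.faceOf (p d) ∈ A ↔ E.faceOf d ∈ A := by
    clear hg
    induction hp using Subgroup.closure_induction with
    | mem p hp =>
      rcases hp with rfl | rfl
      · intro d
        constructor
        · intro h
          by_contra h'
          exact hcon _ h _ ⟨trivial, h'⟩ ⟨E.edge d, rfl, by simp⟩
        · intro h
          by_contra h'
          exact hcon _ h _ ⟨trivial, h'⟩ ⟨d, rfl, rfl⟩
      · intro d
        simp
    | one => simp
    | mul p q _ _ hp hq => intro d; rw [Equiv.Perm.mul_apply, hp, hq]
    | inv p _ hp => intro d; rw [← hp, show p (p⁻¹ d) = d by simp]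
  exact hg ((key d).2 hf)

lemma SideConnected.union {U W : Set E.Face} (hU : E.SideConnected U)
    (hW : ∀ w ∈ W, ∃ u ∈ U, E.FaceAdj w u) : E.SideConnected (U ∪ W) := by
  rintro A hA ⟨f, hf⟩ ⟨g, hg, hgA⟩
  by_cases h1 : (A ∩ U).Nonempty
  · by_cases h2 : (U \ A).Nonempty
    · obtain ⟨a, ha, b, hb, hab⟩ := hU (A ∩ U) Set.inter_subset_right h1
        (by simpa using h2)
      exact ⟨a, ha.1, b, ⟨Or.inl hb.1, fun h => hb.2 ⟨h, hb.1⟩⟩, hab⟩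
    · have h2 : U ⊆ A := by
        rwa [Set.not_nonempty_iff_eq_empty, Set.sdiff_eq_empty] at h2
      rcases hg with hg | hg
      · exact absurd (h2 hg) hgA
      · obtain ⟨u, hu, hgu⟩ := hW g hg
        exact ⟨u, h2 hu, g, ⟨Or.inr hg, hgA⟩, E.faceAdj_symm hgu⟩
  · have h1 : ∀ u ∈ U, u ∉ A := fun u hu h => h1 ⟨u, h, hu⟩
    rcases hA hf with hfU | hfW
    · exact absurd hf (h1 f hfU)
    · obtain ⟨u, hu, hfu⟩ := hW f hfW
      exact ⟨f, hf, u, ⟨Or.inl hu, h1 u hu⟩, hfu⟩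

/-- A spanning tree of the graph whose vertices are the members of `U` and whose edges are the
common sides: `t f` is the side through which one leaves `f` towards the root `f₀`. -/
lemma SideConnected.exists_tree {U : Set E.Face} (hU : E.SideConnected U) {f₀ : E.Face}
    (h₀ : f₀ ∈ U) : ∃ (h : E.Face → ℕ) (t : E.Face → D), ∀ f ∈ U, f ≠ f₀ →
      E.faceOf (t f) = f ∧ E.faceOf (E.edge (t f)) ∈ U ∧ h (E.faceOf (E.edge (t f))) < h f := by
  obtain ⟨h, hh⟩ := exists_height (fun a b => a ∈ U ∧ b ∈ U ∧ E.FaceAdj a b)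
    (fun f => f = f₀ ∨ f ∉ U) (by
      intro x
      by_cases hx : x ∈ U
      · refine ⟨f₀, Or.inl rfl, ?_⟩
        by_contra hcon
        obtain ⟨a, ⟨haU, ha⟩, b, ⟨hbU, hb⟩, hab⟩ := hU
          {y | y ∈ U ∧ Relation.ReflTransGen (fun a b => a ∈ U ∧ b ∈ U ∧ E.FaceAdj a b) f₀ y}
          (fun y hy => hy.1) ⟨f₀, h₀, Relation.ReflTransGen.refl⟩ ⟨x, hx, fun h => hcon h.2⟩
        exact hb ⟨hbU, ha.tail ⟨haU, hbU, hab⟩⟩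
      · exact ⟨x, Or.inr hx, Relation.ReflTransGen.refl⟩)
  have : ∀ f, ∃ d, f ∈ U → f ≠ f₀ →
      E.faceOf d = f ∧ E.faceOf (E.edge d) ∈ U ∧ h (E.faceOf (E.edge d)) < h f := by
    intro f
    by_cases hf : f ∈ U ∧ f ≠ f₀
    · obtain ⟨g, ⟨hg, -, hgf⟩, hlt⟩ := hh f (by tauto)
      obtain ⟨d, rfl, rfl⟩ := E.faceAdj_symm hgf
      exact ⟨d, fun _ _ => ⟨rfl, hg, hlt⟩⟩
    · obtain ⟨d, -⟩ := E.exists_faceOf_eq f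
      exact ⟨d, fun h1 h2 => absurd ⟨h1, h2⟩ hf⟩
  choose t ht using this
  exact ⟨h, t, ht⟩

variable [Finite D]

/-- Deleting the edges dual to a tree of `2`-cells does not disconnect the `1`-skeleton: working from
the leaves to the root, the two ends of the side `t f` are joined by the other sides of `f`. -/
lemma reflTransGen_vertex (hE : E.IsConnected) {U : Set E.Face} {f₀ : E.Face}
    {h : E.Face → ℕ} {t : E.Face → D} (ht : ∀ f ∈ U, f ≠ f₀ →
      E.faceOf (t f) = f ∧ E.faceOf (E.edge (t f)) ∈ U ∧ h (E.faceOf (E.edge (t f))) < h f)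
    (v w : E.Vertex) :
    Relation.ReflTransGen (fun v w => ∃ d, (∀ f ∈ U, f ≠ f₀ → E.edgeOf (t f) ≠ E.edgeOf d) ∧
      E.vertexOf d = v ∧ E.vertexOf (E.edge d) = w) v w := by
  set r : E.Vertex → E.Vertex → Prop := fun v w =>
    ∃ d, (∀ f ∈ U, f ≠ f₀ → E.edgeOf (t f) ≠ E.edgeOf d) ∧
      E.vertexOf d = v ∧ E.vertexOf (E.edge d) = w with hr
  have hsymm : ∀ {v w}, Relation.ReflTransGen r v w → Relation.ReflTransGen r w v := by
    intro v w H
    have : Std.Symm r := ⟨by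
      rintro v w ⟨d, hd, rfl, rfl⟩
      exact ⟨E.edge d, by simpa using hd, rfl, by simp⟩⟩
    exact Relation.ReflTransGen.stdSymm.symm _ _ H
  obtain ⟨M, hM⟩ : ∃ M, ∀ f, h f ≤ M := by
    obtain ⟨M, hM⟩ := (Set.finite_range h).bddAbove
    exact ⟨M, fun f => hM ⟨f, rfl⟩⟩
  have htree : ∀ N, ∀ f ∈ U, f ≠ f₀ → M - h f ≤ N →
      Relation.ReflTransGen r (E.vertexOf (t f)) (E.vertexOf (E.edge (t f))) := by
    intro N
    induction N using Nat.strong_induction_on with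
    | _ N ih =>
    intro f hf hf0 hN
    obtain ⟨h1, h2, h3⟩ := ht f hf hf0
    have hstep : ∀ d, E.faceOf d = f → d ≠ t f →
        Relation.ReflTransGen r (E.vertexOf d) (E.vertexOf (E.face d)) := by
      intro d hd hdt
      rw [← vertexOf_edge]
      by_cases hX : ∀ g ∈ U, g ≠ f₀ → E.edgeOf (t g) ≠ E.edgeOf d
      · exact Relation.ReflTransGen.single ⟨d, hX, rfl, rfl⟩
      · push Not at hX
        obtain ⟨g, hg, hg0, hgd⟩ := hX
        obtain ⟨k1, k2, k3⟩ := ht g hg hg0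
        rcases E.edgeOf_eq_iff'.1 hgd with rfl | rfl
        · exact absurd (by rw [← hd, k1]) hdt
        · rw [hd] at k3
          have := hM g
          have := ih (M - h g) (by omega) g hg hg0 le_rfl
          simpa using hsymm this
    rw [vertexOf_edge]
    refine hsymm ?_
    have hgo : ∀ i, i + 1 ≤ E.faceLength f → Relation.ReflTransGen r (E.vertexOf (E.face (t f)))
        (E.vertexOf (E.face^[i + 1] (t f))) := by
      intro i
      induction i with
      | zero => intro _; exact Relation.ReflTransGen.refl
      | succ i ihi =>
        intro hi
        refine (ihi (by omega)).trans ?_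
        rw [Function.iterate_succ_apply' E.face (i + 1)]
        refine hstep _ (by simp [h1]) fun heq => ?_
        have := E.iterate_face_inj (d := t f) (i := i + 1) (j := 0) (by rw [h1]; omega)
          (by rw [h1]; omega) heq
        omega
    have hpos : 0 < E.faceLength f := by
      unfold faceLength
      exact (Set.ncard_pos).2 ⟨t f, h1⟩
    have := hgo (E.faceLength f - 1) (by omega)
    have hper := E.iterate_faceLength (t f)
    rw [h1] at hper
    rwa [Nat.sub_add_cancel hpos, hper] at this
  have hall : ∀ d, Relation.ReflTransGen r (E.vertexOf d) (E.vertexOf (E.edge d)) := by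
    intro d
    by_cases hX : ∀ g ∈ U, g ≠ f₀ → E.edgeOf (t g) ≠ E.edgeOf d
    · exact Relation.ReflTransGen.single ⟨d, hX, rfl, rfl⟩
    · push Not at hX
      obtain ⟨g, hg, hg0, hgd⟩ := hX
      have := htree _ g hg hg0 le_rfl
      rcases E.edgeOf_eq_iff'.1 hgd with rfl | rfl
      · exact this
      · simpa using hsymm this
  obtain ⟨d, rfl⟩ := E.exists_vertexOf_eq v
  obtain ⟨d', rfl⟩ := E.exists_vertexOf_eq w
  obtain ⟨p, hp, rfl⟩ := hE d d'
  have key : ∀ d, Relation.ReflTransGen r (E.vertexOf d) (E.vertexOf (p d)) := by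
    induction hp using Subgroup.closure_induction with
    | mem p hp =>
      rcases hp with rfl | rfl
      · exact hall
      · intro d
        rw [← vertexOf_edge]
        exact hall d
    | one => exact fun d => Relation.ReflTransGen.refl
    | mul p q _ _ hp hq => exact fun d => (hq d).trans (hp (q d))
    | inv p _ hp =>
      intro d
      have := hsymm (hp (p⁻¹ d))
      rwa [show p (p⁻¹ d) = d by simp] at this
  exact key d

/-- If the complement of a nonempty set of `2`-cells is connected (and nonempty), then the set has
positive Euler characteristic. The edges dual to a spanning tree of the complement `U`, and the edges
towards `T` at the vertices outside `T` in a spanning forest of the remaining graph, are distinct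
edges outside `T`; there are `|U| - 1` of the former. -/
theorem one_le_eulerChar (hE : E.IsSoccerTiling) {T : Set E.Face} (hT : T.Nonempty)
    (hU : E.SideConnected Tᶜ) (hne : Tᶜ.Nonempty) : 1 ≤ E.eulerChar T := by
  obtain ⟨f₀, h₀⟩ := hne
  obtain ⟨h, t, ht⟩ := hU.exists_tree h₀
  set V : Set E.Vertex := {v | ∃ d, E.faceOf d ∈ T ∧ E.vertexOf d = v} with hV
  set A : Set E.Edge := {e | ∃ d, E.faceOf d ∈ T ∧ E.edgeOf d = e} with hA
  obtain ⟨h', hh'⟩ := exists_height _ (· ∈ V) (by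
    intro x
    obtain ⟨f, hf⟩ := hT
    obtain ⟨d, rfl⟩ := E.exists_faceOf_eq f
    exact ⟨E.vertexOf d, ⟨d, hf, rfl⟩, reflTransGen_vertex hE.isSphere.1 ht _ x⟩)
  have : ∀ v, ∃ d, v ∉ V → (∀ f ∈ Tᶜ, f ≠ f₀ → E.edgeOf (t f) ≠ E.edgeOf d) ∧
      E.vertexOf (E.edge d) = v ∧ h' (E.vertexOf d) < h' v := by
    intro v
    by_cases hv : v ∈ V
    · obtain ⟨d, -⟩ := E.exists_vertexOf_eq v
      exact ⟨d, fun h => absurd hv h⟩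
    · obtain ⟨w, ⟨d, hd, rfl, rfl⟩, hlt⟩ := hh' v hv
      exact ⟨d, fun _ => ⟨hd, rfl, hlt⟩⟩
  choose s hs using this
  have hXcard : ((fun f => E.edgeOf (t f)) '' (Tᶜ \ {f₀})).ncard = (Tᶜ \ {f₀}).ncard := by
    refine Set.InjOn.ncard_image ?_
    rintro f ⟨hf, hf0⟩ g ⟨hg, hg0⟩ hfg
    obtain ⟨a1, a2, a3⟩ := ht f hf hf0
    obtain ⟨b1, b2, b3⟩ := ht g hg hg0
    rcases E.edgeOf_eq_iff'.1 hfg with heq | heq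
    · rw [← a1, ← b1, heq]
    · rw [← heq, b1] at a3
      rw [heq, edge_edge_apply, a1] at b3
      omega
  have hYcard : ((fun v => E.edgeOf (s v)) '' Vᶜ).ncard = Vᶜ.ncard := by
    refine Set.InjOn.ncard_image ?_
    intro v hv w hw hvw
    obtain ⟨a1, a2, a3⟩ := hs v hv
    obtain ⟨b1, b2, b3⟩ := hs w hw
    rcases E.edgeOf_eq_iff'.1 hvw with heq | heq
    · rw [← a2, ← b2, heq]
    · rw [heq, edge_edge_apply] at b2
      rw [b2] at a3
      rw [heq, a2] at b3
      omega
  have hXY : Disjoint ((fun f => E.edgeOf (t f)) '' (Tᶜ \ {f₀}))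
      ((fun v => E.edgeOf (s v)) '' Vᶜ) := by
    rw [Set.disjoint_left]
    rintro _ ⟨f, ⟨hf, hf0⟩, rfl⟩ ⟨v, hv, hfv⟩
    exact (hs v hv).1 f hf hf0 hfv.symm
  have hdis : Disjoint ((fun f => E.edgeOf (t f)) '' (Tᶜ \ {f₀}) ∪
      (fun v => E.edgeOf (s v)) '' Vᶜ) A := by
    rw [Set.disjoint_left]
    rintro _ (⟨f, ⟨hf, hf0⟩, rfl⟩ | ⟨v, hv, rfl⟩) ⟨d, hd, hfd⟩
    · obtain ⟨a1, a2, a3⟩ := ht f hf hf0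
      rcases E.edgeOf_eq_iff'.1 hfd with heq | heq
      · exact hf (by rwa [← a1, heq])
      · rw [heq, edge_edge_apply] at a2
        exact a2 hd
    · obtain ⟨a1, a2, a3⟩ := hs v hv
      rcases E.edgeOf_eq_iff'.1 hfd with heq | heq
      · rw [heq, vertexOf_edge] at a2
        exact hv ⟨_, by simpa using hd, a2⟩
      · rw [heq, edge_edge_apply] at a2
        exact hv ⟨d, hd, a2⟩
  have hle : (((fun f => E.edgeOf (t f)) '' (Tᶜ \ {f₀}) ∪
      (fun v => E.edgeOf (s v)) '' Vᶜ) ∪ A).ncard ≤ Nat.card E.Edge := by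
    rw [← Set.ncard_univ]
    exact Set.ncard_le_ncard (Set.subset_univ _)
  rw [Set.ncard_union_eq hdis, Set.ncard_union_eq hXY, hXcard, hYcard] at hle
  have h1 := Set.ncard_sdiff_singleton_add_one h₀
  have h2 := Set.ncard_add_ncard_compl V
  have h3 := Set.ncard_add_ncard_compl T
  have h4 := hE.isSphere.2
  rw [eulerChar, ← hV, ← hA]
  omega

/-- The complement of a disc is connected: otherwise it consists of two parts that share no side and
have connected complements, so its Euler characteristic is at least `2`. -/
lemma IsDisc.sideConnected_compl (hE : E.IsSoccerTiling) {S : Set E.Face} (hS : E.IsDisc S) :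
    E.SideConnected Sᶜ ∧ Sᶜ.Nonempty := by
  classical
  have := Fintype.ofFinite D
  obtain ⟨hne, hconn, hchi⟩ := hS
  have hconn := sideConnected_of_reflTransGen hconn
  have hcompl := eulerChar_compl hE S
  have hpart : ∀ A B : Set E.Face, Disjoint A B → A ∪ B = Sᶜ → A.Nonempty →
      (∀ f ∈ A, ∀ g ∈ B, ¬ E.FaceAdj f g) → 1 ≤ E.eulerChar A := by
    intro A B hAB hU hA hadj
    have hAc : Aᶜ = S ∪ B := by
      rw [← compl_compl S, ← hU, Set.compl_union]
      ext f
      have : f ∈ A → f ∉ B := fun h1 h2 => Set.disjoint_left.1 hAB h1 h2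
      simp only [Set.mem_compl_iff, Set.mem_union, Set.mem_inter_iff]
      tauto
    have hSA : ∀ f ∈ S, f ∉ A := fun f hf hfA =>
      (show f ∈ Sᶜ from hU ▸ Or.inl hfA) hf
    refine one_le_eulerChar hE hA ?_ (hAc ▸ hne.mono Set.subset_union_left)
    rw [hAc]
    -- A part of `B` that shares no side with the rest of `S ∪ B` shares no side with `A` either.
    have hQ : ∀ Q ⊆ S ∪ B, Q.Nonempty → (∀ f ∈ S, f ∉ Q) →
        ∃ f ∈ Q, ∃ g ∈ (S ∪ B) \ Q, E.FaceAdj f g := by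
      intro Q hQ hQn hSQ
      obtain ⟨s, hs⟩ := hne
      obtain ⟨f, hf, g, hg, hfg⟩ := sideConnected_univ hE.isSphere.1 Q (Set.subset_univ _) hQn
        ⟨s, trivial, hSQ s hs⟩
      refine ⟨f, hf, g, ⟨?_, hg.2⟩, hfg⟩
      have hfB : f ∈ B := (hQ hf).resolve_left fun h => hSQ f h hf
      have : g ∉ A := fun h => hadj g h f hfB (E.faceAdj_symm hfg)
      rw [← hAc]
      exact this
    intro Z hZ hZ1 hZ2
    by_cases h1 : ∀ f ∈ S, f ∉ Z
    · exact hQ Z hZ hZ1 h1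
    by_cases h2 : ∀ f ∈ S, f ∈ Z
    · obtain ⟨f, hf, g, hg, hfg⟩ := hQ ((S ∪ B) \ Z) Set.sdiff_subset hZ2
        (fun f hf h => h.2 (h2 f hf))
      refine ⟨g, by_contra fun h => hg.2 ⟨hg.1, h⟩, f, hf, E.faceAdj_symm hfg⟩
    · push Not at h1 h2
      obtain ⟨a, haS, haZ⟩ := h1
      obtain ⟨b, hbS, hbZ⟩ := h2
      obtain ⟨f, hf, g, hg, hfg⟩ := hconn (Z ∩ S) Set.inter_subset_right ⟨a, haZ, haS⟩
        ⟨b, hbS, fun h => hbZ h.1⟩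
      exact ⟨f, hf.1, g, ⟨Or.inl hg.1, fun h => hg.2 ⟨h, hg.1⟩⟩, hfg⟩
  constructor
  · intro A hA hA1 hA2
    by_contra! hcon
    have hdis : Disjoint A (Sᶜ \ A) := Set.disjoint_sdiff_right
    have hun : A ∪ (Sᶜ \ A) = Sᶜ := Set.union_sdiff_cancel hA
    have e1 := hpart A (Sᶜ \ A) hdis hun hA1 hcon
    have e2 := hpart (Sᶜ \ A) A hdis.symm (by rw [Set.union_comm, hun]) hA2
      (fun f hf g hg h => hcon g hg f hf (E.faceAdj_symm h))
    have e3 := eulerChar_union hE hdis hcon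
    rw [hun] at e3
    omega
  · rw [Set.nonempty_compl]
    rintro rfl
    rw [eulerChar_univ hE] at hchi
    omega

end Planarity

end CombMap

namespace CombMap

/-! ### Cyclic patterns of exposed sides -/

/-- Conditions on the number `N P` of places of a cyclic word of length `k` at which four consecutive
entries satisfy `P`; the entries tell which sides of a `2`-cell are exposed. The arcs of exposed sides
have as many ends as starts, and some exposed sides but not all form an arc. If no four consecutive
sides are exposed, then each arc has at most three sides, and the triples of consecutive sides none of
which is exposed are bounded as needed for the comparison of a boundary with the next layer. -/
def PatternBounds (k : ℕ) (N : (Bool → Bool → Bool → Bool → Bool) → ℕ) : Prop :=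
  N (fun a b _ _ => a && !b) = N (fun a b _ _ => !a && b) ∧
  (N (fun a _ _ _ => a) ≠ 0 → N (fun a _ _ _ => a) ≠ k → 1 ≤ N (fun a b _ _ => a && !b)) ∧
  N (fun a _ _ _ => a) + N (fun a b _ _ => a && !b) ≤ 6 ∧
  (N (fun a _ _ _ => a) ≤ 3 → N (fun a b c d => a && b && c && d) = 0) ∧
  (N (fun a b c d => a && b && c && d) = 0 →
    N (fun a _ _ _ => a) ≤ 3 * N (fun a b _ _ => a && !b) ∧
    (N (fun a _ _ _ => a) ≠ 0 → N (fun a b c _ => !a && !b && !c) + N (fun a _ _ _ => a) +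
      (decide (k = 5)).toNat ≤ 4 * N (fun a b _ _ => a && !b)))

lemma patternBounds_five (x₀ x₁ x₂ x₃ x₄ : Bool) : PatternBounds 5 fun P =>
    (P x₀ x₁ x₂ x₃).toNat + (P x₁ x₂ x₃ x₄).toNat + (P x₂ x₃ x₄ x₀).toNat + (P x₃ x₄ x₀ x₁).toNat +
      (P x₄ x₀ x₁ x₂).toNat := by
  unfold PatternBounds
  revert x₀ x₁ x₂ x₃ x₄
  decide

lemma patternBounds_six (x₀ x₁ x₂ x₃ x₄ x₅ : Bool) : PatternBounds 6 fun P =>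
    (P x₀ x₁ x₂ x₃).toNat + (P x₁ x₂ x₃ x₄).toNat + (P x₂ x₃ x₄ x₅).toNat + (P x₃ x₄ x₅ x₀).toNat +
      (P x₄ x₅ x₀ x₁).toNat + (P x₅ x₀ x₁ x₂).toNat := by
  unfold PatternBounds
  revert x₀ x₁ x₂ x₃ x₄ x₅
  decide

/-! ### Exposed sides of a single `2`-cell -/

section Sides

open scoped Classical

variable {D : Type*} [Fintype D] {E : CombMap D}

variable (E) in
/-- The number of exposed sides of a `2`-cell. -/
noncomputable def exposedAt (T : Set E.Face) (f : E.Face) : ℕ :=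
  E.sideSum f fun d => (E.exposed T d).toNat

variable (E) in
/-- The number of arcs formed by the exposed sides of a `2`-cell (not counting a full circle). -/
noncomputable def arcsAt (T : Set E.Face) (f : E.Face) : ℕ :=
  E.sideSum f fun d => (E.exposed T d && !E.exposed T (E.face d)).toNat

variable (E) in
/-- The number of left turns at corners of a `2`-cell. -/
noncomputable def leftsAt (T : Set E.Face) (f : E.Face) : ℕ :=
  E.sideSum f fun d => (E.exposed T d && E.exposed T (E.face d)).toNat

variable (E) in
/-- No four consecutive sides of a `2`-cell are exposed. -/
def NoFourExposed (T : Set E.Face) : Prop :=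
  ∀ d, (E.exposed T d && E.exposed T (E.face d) && E.exposed T (E.face (E.face d)) &&
    E.exposed T (E.face (E.face (E.face d)))) = false

variable (E) in
/-- The members of `T` without exposed sides. -/
def deep (T : Set E.Face) : Set E.Face :=
  {f | f ∈ T ∧ ∀ d, E.faceOf d = f → E.faceOf (E.edge d) ∈ T}

lemma sum_exposedAt (T : Set E.Face) : ∑ f, E.exposedAt T f = E.boundaryLength T := by
  rw [boundaryLength_eq_sum, ← E.sum_sideSum]; rfl

lemma sum_arcsAt (T : Set E.Face) : ∑ f, E.arcsAt T f = E.rights T := by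
  rw [rights, ← E.sum_sideSum]; rfl

lemma sum_leftsAt (T : Set E.Face) : ∑ f, E.leftsAt T f = E.lefts T := by
  rw [lefts, ← E.sum_sideSum]; rfl

lemma faceLength_five {d : D} (h : E.faceLength (E.faceOf d) = 5) :
    E.face (E.face (E.face (E.face (E.face d)))) = d := by
  have := E.iterate_faceLength d
  rwa [h] at this

lemma faceLength_six {d : D} (h : E.faceLength (E.faceOf d) = 6) :
    E.face (E.face (E.face (E.face (E.face (E.face d))))) = d := by
  have := E.iterate_faceLength d
  rwa [h] at this

lemma sideSum_five {d : D} (h : E.faceLength (E.faceOf d) = 5) (g : D → ℕ) :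
    E.sideSum (E.faceOf d) g = g d + g (E.face d) + g (E.face (E.face d)) +
      g (E.face (E.face (E.face d))) + g (E.face (E.face (E.face (E.face d)))) := by
  rw [sideSum_faceOf, h]
  simp [Finset.sum_range_succ]

lemma sideSum_six {d : D} (h : E.faceLength (E.faceOf d) = 6) (g : D → ℕ) :
    E.sideSum (E.faceOf d) g = g d + g (E.face d) + g (E.face (E.face d)) +
      g (E.face (E.face (E.face d))) + g (E.face (E.face (E.face (E.face d)))) +
      g (E.face (E.face (E.face (E.face (E.face d))))) := by
  rw [sideSum_faceOf, h]
  simp [Finset.sum_range_succ]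

lemma leftsAt_add_arcsAt (T : Set E.Face) (f : E.Face) :
    E.leftsAt T f + E.arcsAt T f = E.exposedAt T f := by
  rw [leftsAt, arcsAt, exposedAt, sideSum, sideSum, sideSum, ← Finset.sum_add_distrib]
  refine Finset.sum_congr rfl fun d _ => ?_
  cases E.exposed T d <;> cases E.exposed T (E.face d) <;> rfl

lemma exposedAt_le (T : Set E.Face) (f : E.Face) : E.exposedAt T f ≤ E.faceLength f := by
  rw [← sideSum_one]
  exact E.sideSum_le fun d _ => Bool.toNat_le _

lemma patternBounds (hE : E.IsSoccerTiling) (T : Set E.Face) (f : E.Face) :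
    PatternBounds (E.faceLength f) fun P => E.sideSum f fun d =>
      (P (E.exposed T d) (E.exposed T (E.face d)) (E.exposed T (E.face (E.face d)))
        (E.exposed T (E.face (E.face (E.face d))))).toNat := by
  obtain ⟨d, rfl⟩ := E.exists_faceOf_eq f
  rcases hE.faceLength_eq (E.faceOf d) with hk | hk
  · simp only [sideSum_five hk, faceLength_five hk, hk]
    exact patternBounds_five ..
  · simp only [sideSum_six hk, faceLength_six hk, hk]
    exact patternBounds_six ..

lemma noFourExposed_of_exposedAt_le (hE : E.IsSoccerTiling) {T : Set E.Face}
    (h : ∀ f, E.exposedAt T f ≤ 3) : E.NoFourExposed T := by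
  intro d
  have h0 := (patternBounds hE T (E.faceOf d)).2.2.2.1 (h _)
  by_contra hd
  rw [Bool.not_eq_false] at hd
  exact (E.sideSum_pos (d := d) (by beta_reduce; rw [hd]; exact Nat.one_pos)).ne' h0

lemma NoFourExposed.sideSum_eq_zero {T : Set E.Face} (hT : E.NoFourExposed T) (f : E.Face) :
    (E.sideSum f fun d => (E.exposed T d && E.exposed T (E.face d) &&
      E.exposed T (E.face (E.face d)) && E.exposed T (E.face (E.face (E.face d)))).toNat) = 0 :=
  E.sideSum_eq_zero fun d _ => by rw [hT d]; rfl

/-- The arcs of exposed sides of a `2`-cell have as many starts as ends. -/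
lemma arcsAt_eq_starts (hE : E.IsSoccerTiling) (T : Set E.Face) (f : E.Face) :
    E.arcsAt T f = E.sideSum f fun d => (!E.exposed T d && E.exposed T (E.face d)).toNat :=
  (patternBounds hE T f).1

lemma one_le_arcsAt (hE : E.IsSoccerTiling) {T : Set E.Face} {f : E.Face}
    (h1 : E.exposedAt T f ≠ 0) (h2 : E.exposedAt T f ≠ E.faceLength f) : 1 ≤ E.arcsAt T f :=
  (patternBounds hE T f).2.1 h1 h2

lemma exposedAt_add_arcsAt_le (hE : E.IsSoccerTiling) (T : Set E.Face) (f : E.Face) :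
    E.exposedAt T f + E.arcsAt T f ≤ 6 :=
  (patternBounds hE T f).2.2.1

lemma exposedAt_le_three_mul (hE : E.IsSoccerTiling) {T : Set E.Face} (hT : E.NoFourExposed T)
    (f : E.Face) : E.exposedAt T f ≤ 3 * E.arcsAt T f :=
  ((patternBounds hE T f).2.2.2.2 (hT.sideSum_eq_zero f)).1

/-- The local form of the comparison of the boundaries of `T` and `deep T`. -/
lemma ring_local (hE : E.IsSoccerTiling) {T : Set E.Face} (hT : E.NoFourExposed T) {f : E.Face}
    (h1 : E.exposedAt T f ≠ 0) :
    (E.sideSum f fun d => (!E.exposed T d && !E.exposed T (E.face d) &&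
      !E.exposed T (E.face (E.face d))).toNat) + E.exposedAt T f +
      (decide (E.faceLength f = 5)).toNat ≤ 4 * E.arcsAt T f := by
  convert ((patternBounds hE T f).2.2.2.2 (hT.sideSum_eq_zero f)).2 h1 <;> rfl

lemma exposed_eq_false_of_notMem {D : Type*} {E : CombMap D} {T : Set E.Face} {d : D}
    (h : E.faceOf d ∉ T) :
    E.exposed T d = false := by
  rw [← Bool.not_eq_true, exposed_eq_true]
  exact fun h' => h h'.1

lemma exposedAt_of_notMem {T : Set E.Face} {f : E.Face} (h : f ∉ T) : E.exposedAt T f = 0 :=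
  E.sideSum_eq_zero fun d hd => by simp [exposed_eq_false_of_notMem (hd ▸ h)]

lemma exposedAt_eq_zero_iff {T : Set E.Face} {f : E.Face} (hf : f ∈ T) :
    E.exposedAt T f = 0 ↔ f ∈ E.deep T := by
  constructor
  · intro h
    refine ⟨hf, ?_⟩
    rintro d rfl
    by_contra hd
    have hx := E.exposed_eq_true.2 ⟨hf, hd⟩
    have := E.sideSum_pos (g := fun d => (E.exposed T d).toNat) (d := d) (by simp [hx])
    rw [exposedAt] at h
    omega
  · rintro ⟨-, h⟩
    refine E.sideSum_eq_zero fun d hd => ?_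
    rw [(E.exposed_eq_false (hd ▸ hf)).2 (h d hd)]
    rfl

lemma exists_exposed_of_ne_zero {T : Set E.Face} {f : E.Face} (h : E.exposedAt T f ≠ 0) :
    ∃ d, E.faceOf d = f ∧ E.faceOf d ∈ T ∧ E.faceOf (E.edge d) ∉ T := by
  by_contra! hcon
  refine h (E.sideSum_eq_zero fun d hd => ?_)
  have : E.exposed T d = false := by
    rw [← Bool.not_eq_true, exposed_eq_true]
    exact fun h => h.2 (hcon d hd h.1)
  rw [this]
  rfl

lemma exposedAt_eq_faceLength {T : Set E.Face} {f : E.Face} (hf : f ∈ T)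
    (h : ∀ d, E.faceOf d = f → E.faceOf (E.edge d) ∉ T) : E.exposedAt T f = E.faceLength f := by
  rw [← sideSum_one]
  refine E.sideSum_congr fun d hd => ?_
  rw [E.exposed_eq_true.2 ⟨hd ▸ hf, h d hd⟩]
  rfl

/-- Different sides of a `2`-cell that are not exposed are shared with different `2`-cells. -/
lemma faceLength_eq_exposedAt_add (hE : E.IsSoccerTiling) {T : Set E.Face} {f : E.Face}
    (hf : f ∈ T) :
    E.faceLength f = E.exposedAt T f + {g | g ∈ T ∧ E.FaceAdj f g}.ncard := by
  have h1 : E.faceLength f = E.exposedAt T f +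
      E.sideSum f fun d => (decide (E.faceOf (E.edge d) ∈ T)).toNat := by
    rw [← sideSum_one, exposedAt, sideSum, sideSum, sideSum, ← Finset.sum_add_distrib]
    refine Finset.sum_congr rfl fun d hd => ?_
    have hd : E.faceOf d ∈ T := (Finset.mem_filter.1 hd).2 ▸ hf
    by_cases h : E.faceOf (E.edge d) ∈ T
    · simp [(E.exposed_eq_false hd).2 h, h]
    · simp [E.exposed_eq_true.2 ⟨hd, h⟩, h]
  rw [h1]
  congr 1
  have h2 : (E.sideSum f fun d => (decide (E.faceOf (E.edge d) ∈ T)).toNat)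
      = {d | E.faceOf d = f ∧ E.faceOf (E.edge d) ∈ T}.ncard := by
    rw [ncard_eq_sum, sideSum, Finset.sum_filter]
    refine Finset.sum_congr rfl fun d _ => ?_
    by_cases h1 : E.faceOf d = f <;> by_cases h2 : E.faceOf (E.edge d) ∈ T <;> simp [h1, h2]
  have h3 : {g | g ∈ T ∧ E.FaceAdj f g}
      = (fun d => E.faceOf (E.edge d)) '' {d | E.faceOf d = f ∧ E.faceOf (E.edge d) ∈ T} := by
    ext g
    constructor
    · rintro ⟨hg, d, rfl, rfl⟩
      exact ⟨d, ⟨rfl, hg⟩, rfl⟩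
    · rintro ⟨d, ⟨rfl, hd⟩, rfl⟩
      exact ⟨hd, d, rfl, rfl⟩
  rw [h2, h3, Set.InjOn.ncard_image]
  rintro d ⟨hd, -⟩ d' ⟨hd', -⟩ h
  exact hE.hasSimplicialDual.2.1 d d' (hd.trans hd'.symm) h

lemma faceLength_le_exposedAt_add (hE : E.IsSoccerTiling) {T : Set E.Face} {f : E.Face}
    (hf : f ∈ T) : E.faceLength f ≤ E.exposedAt T f + (T \ {f}).ncard := by
  rw [faceLength_eq_exposedAt_add hE hf]
  gcongr
  · exact Set.toFinite _
  · rintro g ⟨hg, d, rfl, rfl⟩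
    exact ⟨hg, fun h => hE.hasSimplicialDual.1 d h.symm⟩

lemma boundaryLength_diff_singleton (hE : E.IsSoccerTiling) {T : Set E.Face} {f : E.Face}
    (hf : f ∈ T) : E.boundaryLength (T \ {f}) + 2 * E.exposedAt T f
      = E.boundaryLength T + E.faceLength f := by
  have hs : ∀ g : D → ℤ, (∑ d with E.faceOf d = f, g d) = ∑ d, if E.faceOf d = f then g d else 0 :=
    fun g => Finset.sum_filter _ _
  rw [← sideSum_one, boundaryLength_eq_sum, boundaryLength_eq_sum, exposedAt, sideSum, sideSum]
  zify
  rw [hs, hs]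
  have key : ∑ d, (if E.faceOf (E.edge d) = f then ((E.inside T d).toNat : ℤ) else 0)
      = ∑ d, if E.faceOf d = f then (1 : ℤ) - (E.exposed T d).toNat else 0 := by
    rw [← E.sum_edge]
    refine Finset.sum_congr rfl fun d _ => ?_
    rw [edge_edge_apply, exposed_eq]
    by_cases h : E.faceOf d = f
    · have : E.inside T d = true := E.inside_eq_true.2 (h ▸ hf)
      rw [this]
      cases E.inside T (E.edge d) <;> simp [h]
    · simp [h]
  have main : ∑ d, ((E.exposed (T \ {f}) d).toNat : ℤ) = ∑ d, (((E.exposed T d).toNat : ℤ)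
      - (if E.faceOf d = f then ((E.exposed T d).toNat : ℤ) else 0)
      + (if E.faceOf (E.edge d) = f then ((E.inside T d).toNat : ℤ) else 0)) := by
    refine Finset.sum_congr rfl fun d _ => ?_
    have hne := hE.hasSimplicialDual.1 d
    by_cases h1 : E.faceOf d = f
    · have h2 : E.faceOf (E.edge d) ≠ f := fun h => hne (h1.trans h.symm)
      have h3 : E.exposed (T \ {f}) d = false := exposed_eq_false_of_notMem (by simp [h1])
      simp [h1, h2, h3]
    · by_cases h2 : E.faceOf (E.edge d) = f
      · by_cases h3 : E.faceOf d ∈ T <;> simp [exposed, inside, IsBoundaryDart, h1, h2, h3, hf]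
      · by_cases h3 : E.faceOf d ∈ T <;> by_cases h4 : E.faceOf (E.edge d) ∈ T <;>
          simp [exposed, IsBoundaryDart, h1, h2, h3, h4]
  rw [main, Finset.sum_add_distrib, Finset.sum_sub_distrib, key, two_mul]
  have : ∀ d, (if E.faceOf d = f then (1 : ℤ) - (E.exposed T d).toNat else 0)
      = (if E.faceOf d = f then (1 : ℤ) else 0)
        - (if E.faceOf d = f then ((E.exposed T d).toNat : ℤ) else 0) := by
    intro d; split_ifs <;> simp
  simp only [this, Finset.sum_sub_distrib]
  ring

lemma boundaryLength_singleton (hE : E.IsSoccerTiling) (f : E.Face) :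
    E.boundaryLength {f} = E.faceLength f := by
  have h1 := boundaryLength_diff_singleton hE (Set.mem_singleton f)
  have h2 : E.exposedAt {f} f = E.faceLength f := exposedAt_eq_faceLength rfl (by
    rintro d rfl h
    exact hE.hasSimplicialDual.1 d h.symm)
  have h3 : E.boundaryLength ({f} \ {f}) = 0 := by
    simp [boundaryLength, IsBoundaryDart]
  omega

lemma numPentagons_diff_singleton {T : Set E.Face} {f : E.Face} (hf : f ∈ T) :
    E.numPentagons (T \ {f}) + (decide (E.faceLength f = 5)).toNat = E.numPentagons T := by
  have h := numPentagons_union (E := E) (A := T \ {f}) (B := {f}) Set.disjoint_sdiff_left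
  rw [Set.sdiff_union_of_subset (by simpa using hf)] at h
  rw [h]
  congr 1
  rw [numPentagons_eq_sum, Finset.sum_eq_single f]
  · simp
  · intro g _ hg
    simp [hg]
  · simp

lemma numPentagons_eq_zero_iff {T : Set E.Face} :
    E.numPentagons T = 0 ↔ ∀ f ∈ T, E.faceLength f ≠ 5 := by
  rw [numPentagons, Set.ncard_eq_zero, Set.eq_empty_iff_forall_notMem]
  simp

lemma numPentagons_eq_ncard {D : Type*} {E : CombMap D} {T : Set E.Face}
    (h : ∀ f ∈ T, E.faceLength f = 5) :
    E.numPentagons T = T.ncard := by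
  rw [numPentagons]
  congr 1
  ext f
  simpa using h f

/-- The number of arcs formed by the exposed sides of pentagons. -/
noncomputable def pentagonArcs (T : Set E.Face) : ℕ :=
  ∑ f, (decide (E.faceLength f = 5)).toNat * E.arcsAt T f

/-- At most one of the two `2`-cells at a right turn is a pentagon. -/
lemma two_mul_pentagonArcs_le (hE : E.IsSoccerTiling) (T : Set E.Face) :
    2 * pentagonArcs T ≤ E.rights T := by
  have h1 : pentagonArcs T = ∑ d, (!E.exposed T d && E.exposed T (E.face d) &&
      decide (E.faceLength (E.faceOf d) = 5)).toNat := by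
    rw [pentagonArcs, ← E.sum_sideSum]
    refine Finset.sum_congr rfl fun f _ => ?_
    rw [arcsAt_eq_starts hE, sideSum, sideSum, Finset.mul_sum]
    refine Finset.sum_congr rfl fun d hd => ?_
    rw [(Finset.mem_filter.1 hd).2]
    cases decide (E.faceLength f = 5) <;> simp
  have h2 : pentagonArcs T = ∑ d, (E.exposed T d && !E.exposed T (E.face d) &&
      decide (E.faceLength (E.faceOf d) = 5)).toNat := by
    rw [pentagonArcs, ← E.sum_sideSum]
    refine Finset.sum_congr rfl fun f _ => ?_
    rw [arcsAt, sideSum, sideSum, Finset.mul_sum]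
    refine Finset.sum_congr rfl fun d hd => ?_
    rw [(Finset.mem_filter.1 hd).2]
    cases decide (E.faceLength f = 5) <;> simp
  have h3 : pentagonArcs T ≤ ∑ d, (E.exposed T d && !E.exposed T (E.face d) &&
      !decide (E.faceLength (E.faceOf d) = 5)).toNat := by
    rw [h1, ← Equiv.sum_comp (E.edge.trans E.face.symm)
      fun d => (E.exposed T d && !E.exposed T (E.face d) &&
      !decide (E.faceLength (E.faceOf d) = 5)).toNat]
    refine Finset.sum_le_sum fun d _ => Bool.toNat_le_toNat ?_
    intro h
    simp only [Bool.and_eq_true, Bool.not_eq_true', decide_eq_true_eq, exposed_eq_true,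
      faceOf_face] at h
    obtain ⟨⟨h1, h2, h3⟩, h4⟩ := h
    have h5 : E.faceOf (E.edge d) ∈ T := (E.exposed_eq_false h2).1 h1
    have h6 := E.face_edge_face hE.vertexDegree_eq d
    have h7 : E.exposed T (E.face.symm (E.edge d)) = true := by
      rw [exposed_eq_true, ← h6]
      simp only [edge_edge_apply, faceOf_face]
      exact ⟨by rw [h6]; simpa using h5, h3⟩
    have h8 : E.exposed T (E.edge d) = false := (E.exposed_eq_false h5).2 (by simpa using h2)
    have h9 : E.faceLength (E.faceOf (E.edge d)) ≠ 5 :=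
      fun h => hE.not_adj _ _ h4 h ⟨d, rfl, rfl⟩
    simp [h7, h8, h9]
  have h4 : E.rights T = (∑ d, (E.exposed T d && !E.exposed T (E.face d) &&
      decide (E.faceLength (E.faceOf d) = 5)).toNat) + ∑ d, (E.exposed T d &&
      !E.exposed T (E.face d) && !decide (E.faceLength (E.faceOf d) = 5)).toNat := by
    rw [rights, ← Finset.sum_add_distrib]
    refine Finset.sum_congr rfl fun d _ => ?_
    cases E.exposed T d <;> cases E.exposed T (E.face d) <;>
      cases decide (E.faceLength (E.faceOf d) = 5) <;> rfl
  omega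

/-- A comparison of the boundaries of `T` and `deep T`: the sides between `deep T` and the rest of
`T` are neither exposed nor adjacent to exposed sides. -/
lemma boundaryLength_deep_add_le (hE : E.IsSoccerTiling) {T : Set E.Face}
    (hT : E.NoFourExposed T) :
    E.boundaryLength (E.deep T) + E.boundaryLength T + E.numPentagons T
      ≤ 4 * E.rights T + E.numPentagons (E.deep T) := by
  have hsub : E.deep T ⊆ T := fun f hf => hf.1
  obtain ⟨R, hR⟩ : ∃ R, R = T \ E.deep T := ⟨_, rfl⟩
  have hp := numPentagons_union (E := E) (A := E.deep T) (B := R) (hR ▸ Set.disjoint_sdiff_right)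
  rw [hR, Set.union_sdiff_cancel hsub, ← hR] at hp
  have h1 : E.boundaryLength (E.deep T) ≤ ∑ d, (decide (E.faceOf d ∈ R) &&
      (!E.exposed T d && !E.exposed T (E.face d) && !E.exposed T (E.face (E.face d)))).toNat := by
    rw [boundaryLength_eq_sum, ← Equiv.sum_comp (E.face.trans E.edge)]
    refine Finset.sum_le_sum fun d _ => Bool.toNat_le_toNat ?_
    intro h
    simp only [Equiv.trans_apply, exposed_eq_true, edge_edge_apply, faceOf_face] at h
    obtain ⟨⟨h1, h2⟩, h3⟩ := h
    have hd : E.faceOf d ∈ T := by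
      simpa using h2 (E.edge (E.face d)) rfl
    have a1 : E.exposed T d = false := by
      rw [E.exposed_eq_false hd]
      have h4 := h2 (E.face (E.edge (E.face d))) (by simp)
      rwa [E.face_edge_face hE.vertexDegree_eq, faceOf_face_symm] at h4
    have a2 : E.exposed T (E.face d) = false := by
      rw [E.exposed_eq_false (by simpa using hd)]
      exact h1
    have a3 : E.exposed T (E.face (E.face d)) = false := by
      rw [E.exposed_eq_false (by simpa using hd)]
      have h4 := h2 (E.face.symm (E.edge (E.face d))) (by simp)
      rwa [← E.face_edge_face hE.vertexDegree_eq, edge_edge_apply, faceOf_face] at h4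
    simp [hR, a1, a2, a3, hd, h3]
  rw [← E.sum_sideSum] at h1
  rw [hp, ← sum_exposedAt T, ← sum_arcsAt, E.numPentagons_eq_sum R, Finset.mul_sum]
  have h2 : ∀ f, (E.sideSum f fun d => (decide (E.faceOf d ∈ R) &&
      (!E.exposed T d && !E.exposed T (E.face d) && !E.exposed T (E.face (E.face d)))).toNat)
      + E.exposedAt T f + (decide (f ∈ R ∧ E.faceLength f = 5)).toNat
      ≤ 4 * E.arcsAt T f := by
    intro f
    by_cases hf : f ∈ R
    · have hf' : f ∈ T \ E.deep T := hR ▸ hf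
      have h0 : E.exposedAt T f ≠ 0 := fun h => hf'.2 ((exposedAt_eq_zero_iff hf'.1).1 h)
      refine le_trans (le_of_eq ?_) (ring_local hE hT h0)
      congr 1
      · congr 1
        refine E.sideSum_congr fun d hd => ?_
        rw [hd, decide_eq_true hf, Bool.true_and]
      · simp only [hf, true_and]
    · have h0 : E.exposedAt T f = 0 := by
        by_cases hfT : f ∈ T
        · exact (exposedAt_eq_zero_iff hfT).2 (by simpa [hR, hfT] using hf)
        · exact exposedAt_of_notMem hfT
      rw [h0, E.sideSum_eq_zero]
      · simp [hf]
      · intro d hd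
        rw [hd, decide_eq_false hf]
        rfl
  have h3 := Finset.sum_le_sum fun f (_ : f ∈ Finset.univ) => h2 f
  rw [Finset.sum_add_distrib, Finset.sum_add_distrib] at h3
  omega

end Sides

end CombMap

namespace CombMap

/-! ### The isoperimetric inequality -/

section Isoperimetry

open scoped Classical

variable {D : Type*} [Fintype D] {E : CombMap D}

variable (E) in
/-- The lower bounds for the boundary length of a set of `2`-cells with at most six pentagons and
connected complement, together with the information on the extremal cases that makes an induction
on the number of `2`-cells possible. -/
structure IsoperimetricBounds (T : Set E.Face) : Prop where
  of_zero : E.numPentagons T = 0 → 6 ≤ E.boundaryLength T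
  of_one : E.numPentagons T = 1 → 9 ≤ E.boundaryLength T ∨ ∃ f, T = {f}
  of_two : E.numPentagons T = 2 → 10 ≤ E.boundaryLength T
  of_two' : E.numPentagons T = 2 → 12 ≤ E.boundaryLength T ∨ ∀ f ∈ T, E.faceLength f = 5
  of_three_le : 3 ≤ E.numPentagons T → 15 ≤ E.boundaryLength T

lemma lefts_le_of_leftsAt_le {T : Set E.Face} {c : ℕ}
    (h : ∀ f ∈ T, E.leftsAt T f ≤ E.arcsAt T f + c * (decide (E.faceLength f = 5)).toNat) :
    E.lefts T ≤ E.rights T + c * E.numPentagons T := by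
  rw [← sum_leftsAt, ← sum_arcsAt, numPentagons_eq_sum, Finset.mul_sum, ← Finset.sum_add_distrib]
  refine Finset.sum_le_sum fun f _ => ?_
  by_cases hf : f ∈ T
  · simpa [hf] using h f hf
  · have h1 := leftsAt_add_arcsAt T f
    rw [exposedAt_of_notMem hf] at h1
    omega

lemma sideConnected_compl_deep {T : Set E.Face} (hT : E.SideConnected Tᶜ) :
    E.SideConnected (E.deep T)ᶜ := by
  have : (E.deep T)ᶜ = Tᶜ ∪ (T \ E.deep T) := by
    ext f
    have : f ∈ E.deep T → f ∈ T := fun h => h.1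
    simp only [Set.mem_compl_iff, Set.mem_union, Set.mem_sdiff]
    tauto
  rw [this]
  refine hT.union ?_
  rintro f ⟨hf, hfd⟩
  obtain ⟨d, rfl, -, hd⟩ := exists_exposed_of_ne_zero
    fun h => hfd ((exposedAt_eq_zero_iff hf).1 h)
  exact ⟨_, hd, d, rfl, rfl⟩

lemma sideConnected_compl_diff_singleton {T : Set E.Face} (hT : E.SideConnected Tᶜ) {f : E.Face}
    (hf : E.exposedAt T f ≠ 0) : E.SideConnected (T \ {f})ᶜ := by
  have : (T \ {f})ᶜ = Tᶜ ∪ {f} := by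
    ext g
    simp only [Set.mem_compl_iff, Set.mem_union, Set.mem_sdiff, Set.mem_singleton_iff]
    tauto
  rw [this]
  refine hT.union ?_
  rintro g rfl
  obtain ⟨d, rfl, -, hd⟩ := exists_exposed_of_ne_zero hf
  exact ⟨_, hd, d, rfl, rfl⟩

/-- In a connected surface, a nonempty proper set of `2`-cells has a member with exposed sides. -/
lemma deep_ssubset {D : Type*} {E : CombMap D} (hE : E.IsSoccerTiling) {T : Set E.Face}
    (h1 : T.Nonempty) (h2 : Tᶜ.Nonempty) : E.deep T ⊂ T := by
  refine ⟨fun f hf => hf.1, fun hsub => ?_⟩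
  obtain ⟨f, hf, g, hg, d, rfl, rfl⟩ := sideConnected_univ hE.isSphere.1 T (Set.subset_univ _) h1
    (by rwa [← Set.compl_eq_univ_sdiff])
  exact hg.2 ((hsub hf).2 d rfl)

/-- The isoperimetric inequality. In a minimal counterexample, no `2`-cell with many exposed sides can
be removed, so there are too few left turns for the Gauss–Bonnet formula, with two exceptions. If
there are three pentagons, then they have at least three arcs of exposed sides, hence there are at
least six right turns (as pentagons share no sides) and nine left turns. If there are six pentagons,
then no `2`-cell has more than two exposed sides, and the members without exposed sides form a smaller
counterexample. -/
theorem isoperimetricBounds (hE : E.IsSoccerTiling) {T : Set E.Face} (hne : T.Nonempty)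
    (hconn : E.SideConnected Tᶜ) (hcne : Tᶜ.Nonempty) (hp : E.numPentagons T ≤ 6) :
    E.IsoperimetricBounds T := by
  induction hN : T.ncard using Nat.strong_induction_on generalizing T with
  | _ N ih =>
  subst hN
  have hK := six_mul_eulerChar hE T
  have hchi := one_le_eulerChar hE hne hconn hcne
  have hlr := E.lefts_add_rights T
  have hbp := two_mul_pentagonArcs_le hE T
  -- The induction hypothesis for the complement in `T` of a `2`-cell with exposed sides.
  have hrem : ∀ f ∈ T, E.exposedAt T f ≠ 0 → (T \ {f}).Nonempty →
      E.IsoperimetricBounds (T \ {f}) := by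
    intro f hf h0 hn
    have h1 := numPentagons_diff_singleton hf
    refine ih _ ?_ hn (sideConnected_compl_diff_singleton hconn h0)
      (hcne.mono (Set.compl_subset_compl.2 Set.sdiff_subset)) (by omega) rfl
    have := Set.ncard_sdiff_singleton_add_one hf
    omega
  have hlen : ∀ f, (E.faceLength f = 5 ∧ (decide (E.faceLength f = 5)).toNat = 1) ∨
      (E.faceLength f = 6 ∧ (decide (E.faceLength f = 5)).toNat = 0) := by
    intro f
    rcases hE.faceLength_eq f with h | h <;> simp [h]
  have hleft : ∀ f, E.exposedAt T f ≤ 4 → E.leftsAt T f + 1 ≤ E.exposedAt T f ∨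
      E.leftsAt T f = 0 := by
    intro f h4
    have h1 := leftsAt_add_arcsAt T f
    by_cases h0 : E.exposedAt T f = 0
    · right; omega
    · have := one_le_arcsAt hE h0 (by rcases hlen f with h | h <;> omega)
      left; omega
  have hsing : ∀ f, T = {f} → E.boundaryLength T = E.faceLength f := by
    rintro f rfl
    exact boundaryLength_singleton hE f
  have hdiff : ∀ f ∈ T, ¬ (T \ {f}).Nonempty → T = {f} := by
    intro f hf h
    rw [Set.not_nonempty_iff_eq_empty, Set.sdiff_eq_empty] at h
    exact Set.Subset.antisymm h (by simpa using hf)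
  have hpent : ∀ f ∈ T, E.faceLength f = 5 → 1 ≤ E.numPentagons T := by
    intro f hf h
    have := numPentagons_diff_singleton hf
    rcases hlen f with h' | h' <;> omega
  -- A pentagon is not adjacent to any of the others.
  have hisol : ∀ f ∈ T, E.faceLength f = 5 → (∀ g ∈ T \ {f}, E.faceLength g = 5) →
      E.exposedAt T f = 5 := by
    intro f hf h5 h
    rw [exposedAt_eq_faceLength hf, h5]
    rintro d rfl hd
    exact hE.not_adj _ _ h5 (h _ ⟨hd, fun h => hE.hasSimplicialDual.1 d h.symm⟩) ⟨d, rfl, rfl⟩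
  have hdel := fun f (hf : f ∈ T) => boundaryLength_diff_singleton hE hf
  have hdelp := fun f (hf : f ∈ T) => numPentagons_diff_singleton hf
  have hrest : 2 ≤ E.numPentagons T → ∀ f ∈ T, (T \ {f}).Nonempty := by
    intro h2 f hf
    by_contra h
    have h3 := hdelp f hf
    rw [Set.not_nonempty_iff_eq_empty.1 h] at h3
    have h4 : E.numPentagons ∅ = 0 := numPentagons_eq_zero_iff.2 (by simp)
    have := Bool.toNat_le (decide (E.faceLength f = 5))
    omega
  refine ⟨fun h0 => ?_, fun h1 => ?_, fun h2 => ?_, fun h2 => ?_, fun h3 => ?_⟩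
  · by_contra! hn
    have hex : ∀ f ∈ T, E.exposedAt T f ≤ 2 := by
      intro f hf
      by_contra! ha
      have e1 := hdel f hf
      have e2 := hdelp f hf
      rcases hlen f with ⟨h5, h5'⟩ | ⟨h6, h6'⟩
      · have := hpent f hf h5; omega
      by_cases hn' : (T \ {f}).Nonempty
      · have := (hrem f hf (by omega) hn').of_zero (by omega)
        omega
      · have := hsing f (hdiff f hf hn')
        omega
    have := lefts_le_of_leftsAt_le (T := T) (c := 0) (fun f hf => by
      have h1 := hex f hf
      have h2 := leftsAt_add_arcsAt T f
      rcases hleft f (by omega) with h | h <;> omega)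
    omega
  · by_contra! hn
    obtain ⟨hn, hns⟩ := hn
    have hrest : ∀ f ∈ T, (T \ {f}).Nonempty := fun f hf => by_contra fun h => hns f (hdiff f hf h)
    have := lefts_le_of_leftsAt_le (T := T) (c := 2) (fun f hf => by
      have e1 := hdel f hf
      have e2 := hdelp f hf
      have e3 := leftsAt_add_arcsAt T f
      have e4 := exposedAt_le T f
      rcases hlen f with ⟨h5, h5'⟩ | ⟨h6, h6'⟩
      · by_cases ha : E.exposedAt T f = 5
        · have := (hrem f hf (by omega) (hrest f hf)).of_zero (by omega)
          omega
        · rcases hleft f (by omega) with h | h <;> omega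
      · by_cases ha : 3 ≤ E.exposedAt T f
        · rcases (hrem f hf (by omega) (hrest f hf)).of_one (by omega) with h | ⟨g, hg⟩
          · omega
          · have e5 := faceLength_le_exposedAt_add hE hf
            have e6 := boundaryLength_singleton hE g
            rw [hg, Set.ncard_singleton] at e5
            rw [hg] at e1
            rcases hlen g with h | h <;> omega
        · rcases hleft f (by omega) with h | h <;> omega)
    omega
  · by_contra! hn
    have hrest := hrest (by omega)
    have := lefts_le_of_leftsAt_le (T := T) (c := 1) (fun f hf => by
      have e1 := hdel f hf
      have e2 := hdelp f hf
      have e3 := leftsAt_add_arcsAt T f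
      have e4 := exposedAt_le T f
      rcases hlen f with ⟨h5, h5'⟩ | ⟨h6, h6'⟩
      · by_cases ha : 4 ≤ E.exposedAt T f
        · rcases (hrem f hf (by omega) (hrest f hf)).of_one (by omega) with h | ⟨g, hg⟩
          · omega
          · have e6 := boundaryLength_singleton hE g
            have e7 : E.numPentagons {g} = 1 := by rw [← hg]; omega
            have e8 : E.faceLength g = 5 := by
              by_contra h
              have := (numPentagons_eq_zero_iff (E := E) (T := {g})).2 (by simpa using h)
              omega
            have := hisol f hf h5 (by rw [hg]; simpa using e8)
            rw [hg] at e1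
            omega
        · rcases hleft f (by omega) with h | h <;> omega
      · by_cases ha : 3 ≤ E.exposedAt T f
        · have := (hrem f hf (by omega) (hrest f hf)).of_two (by omega)
          omega
        · rcases hleft f (by omega) with h | h <;> omega)
    omega
  · by_contra! hn
    obtain ⟨hn, h, hh, hh5⟩ := hn
    have hrest := hrest (by omega)
    have := lefts_le_of_leftsAt_le (T := T) (c := 1) (fun f hf => by
      have e1 := hdel f hf
      have e2 := hdelp f hf
      have e3 := leftsAt_add_arcsAt T f
      have e4 := exposedAt_le T f
      rcases hlen f with ⟨h5, h5'⟩ | ⟨h6, h6'⟩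
      · by_cases ha : 4 ≤ E.exposedAt T f
        · rcases (hrem f hf (by omega) (hrest f hf)).of_one (by omega) with h' | ⟨g, hg⟩
          · omega
          · have e7 : E.numPentagons {g} = 1 := by rw [← hg]; omega
            have e8 : h ∈ T \ {f} := ⟨hh, fun e => hh5 (e ▸ h5)⟩
            rw [hg, Set.mem_singleton_iff] at e8
            have := (numPentagons_eq_zero_iff (E := E) (T := {g})).2 (by simpa [← e8] using hh5)
            omega
        · rcases hleft f (by omega) with h | h <;> omega
      · by_cases ha : 3 ≤ E.exposedAt T f
        · have e5 := hrem f hf (by omega) (hrest f hf)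
          rcases e5.of_two' (by omega) with h' | h'
          · omega
          · have e6 := e5.of_two (by omega)
            have e7 := numPentagons_eq_ncard h'
            have e8 := faceLength_le_exposedAt_add hE hf
            omega
        · rcases hleft f (by omega) with h | h <;> omega)
    omega
  · by_contra! hn
    have hrest := hrest (by omega)
    have hhex : ∀ f ∈ T, E.faceLength f = 6 → E.exposedAt T f ≤ 2 := by
      intro f hf h6
      by_contra! ha
      have e1 := hdel f hf
      have e2 := hdelp f hf
      have := (hrem f hf (by omega) (hrest f hf)).of_three_le (by
        rcases hlen f with h | h <;> omega)
      omega
    rcases Nat.lt_or_ge 3 (E.numPentagons T) with h4 | h4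
    · have hall : ∀ f, E.exposedAt T f ≤ 2 := by
        intro f
        by_cases hf : f ∈ T
        · rcases hlen f with ⟨h5, h5'⟩ | ⟨h6, h6'⟩
          · by_contra! ha
            have e1 := hdel f hf
            have e2 := hdelp f hf
            have := (hrem f hf (by omega) (hrest f hf)).of_three_le (by omega)
            omega
          · exact hhex f hf h6
        · rw [exposedAt_of_notMem hf]
          omega
      have hle := lefts_le_of_leftsAt_le (T := T) (c := 0) (fun f hf => by
        have h1 := hall f
        have h2 := leftsAt_add_arcsAt T f
        rcases hleft f (by omega) with h | h <;> omega)
      have hring := boundaryLength_deep_add_le hE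
        (noFourExposed_of_exposedAt_le hE fun f => (hall f).trans (by norm_num))
      have hss := deep_ssubset hE hne hcne
      -- The pentagons with exposed sides have at least one arc each.
      have hq : E.numPentagons T ≤ E.numPentagons (E.deep T) + pentagonArcs T := by
        rw [numPentagons_eq_sum, numPentagons_eq_sum, pentagonArcs, ← Finset.sum_add_distrib]
        refine Finset.sum_le_sum fun f _ => ?_
        by_cases hf : f ∈ T
        · by_cases hd : f ∈ E.deep T
          · simp [hf, hd]
          · have h0 : E.exposedAt T f ≠ 0 := fun h => hd ((exposedAt_eq_zero_iff hf).1 h)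
            have h1 := hall f
            have := one_le_arcsAt hE h0 (by rcases hlen f with h | h <;> omega)
            by_cases h5 : E.faceLength f = 5
            · simpa [hf, hd, h5] using this
            · simp [h5]
        · simp [hf]
      have hdn : (E.deep T).Nonempty := by
        by_contra h
        rw [Set.not_nonempty_iff_eq_empty] at h
        have h4 : E.numPentagons (E.deep T) = 0 := numPentagons_eq_zero_iff.2 (by simp [h])
        omega
      have hdp : E.numPentagons (E.deep T) ≤ E.numPentagons T := by
        have := numPentagons_union (E := E) (A := E.deep T) (B := T \ E.deep T)
          Set.disjoint_sdiff_right
        rw [Set.union_sdiff_cancel hss.1] at this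
        omega
      have := (ih _ (Set.ncard_lt_ncard hss) hdn (sideConnected_compl_deep hconn)
        (hcne.mono (Set.compl_subset_compl.2 hss.1)) (by omega) rfl).of_three_le (by omega)
      omega
    · have hle : E.lefts T ≤ E.rights T + pentagonArcs T := by
        rw [← sum_leftsAt, ← sum_arcsAt, pentagonArcs, ← Finset.sum_add_distrib]
        refine Finset.sum_le_sum fun f _ => ?_
        have h2 := leftsAt_add_arcsAt T f
        by_cases hf : f ∈ T
        · rcases hlen f with ⟨h5, h5'⟩ | ⟨h6, h6'⟩
          · rw [h5', one_mul]
            have ha : E.exposedAt T f ≤ 3 := by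
              by_contra! ha
              have e1 := hdel f hf
              have e2 := hdelp f hf
              have e5 := hrem f hf (by omega) (hrest f hf)
              rcases e5.of_two' (by omega) with h | h
              · omega
              · have := hisol f hf h5 h
                have := e5.of_two (by omega)
                omega
            by_cases h0 : E.exposedAt T f = 0
            · omega
            · have := one_le_arcsAt hE h0 (by omega)
              omega
          · have := hhex f hf h6
            rcases hleft f (by omega) with h | h <;> omega
        · rw [exposedAt_of_notMem hf] at h2
          omega
      omega

end Isoperimetry

end CombMap

namespace CombMap

/-! ### The shape of the diagram -/

section Shape

open scoped Classical

variable {D : Type*} [Fintype D] {E : CombMap D} {S : Set E.Face}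

lemma noFourExposed_of_not_hasExposedPath {D : Type*} {E : CombMap D} {S : Set E.Face}
    (h : ¬ E.HasExposedPath S 4) : E.NoFourExposed S := by
  intro d
  by_contra hd
  simp only [Bool.not_eq_false, Bool.and_eq_true, exposed, decide_eq_true_eq] at hd
  obtain ⟨⟨⟨h0, h1⟩, h2⟩, h3⟩ := hd
  refine h ⟨d, h0, fun j hj => ?_⟩
  have t0 : E.turn S d = Turn.left := by simp [turn, h1]
  have t1 : E.turn S (E.face d) = Turn.left := by simp [turn, h2]
  have t2 : E.turn S (E.face (E.face d)) = Turn.left := by simp [turn, h3]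
  have n0 : E.nextBoundary S d = E.face d := by simp [nextBoundary, t0]
  have n1 : E.nextBoundary S (E.face d) = E.face (E.face d) := by simp [nextBoundary, t1]
  have : j < 3 := by omega
  interval_cases j
  · exact t0
  · simp [turnPattern, n0, t1]
  · simp [turnPattern, n0, n1, t2]

/-- The diagram has two pentagons, and each of its `2`-cells has exactly one arc of exposed sides.
These arcs have length `3`, except possibly one that has length `2`. -/
lemma shape (hS : E.IsSoccerDiagram S) (hlen : E.boundaryLength S ≤ 14)
    (hpent : E.numPentagons S ≤ 6) (hexp : E.NoFourExposed S) :
    E.numPentagons S = 2 ∧ (∀ f ∈ S, E.arcsAt S f = 1) ∧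
      ((S.ncard = 4 ∧ ∀ f ∈ S, E.exposedAt S f = 3) ∨
        (S.ncard = 5 ∧ ∃ z ∈ S, E.exposedAt S z = 2 ∧ ∀ f ∈ S, f ≠ z → E.exposedAt S f = 3)) := by
  obtain ⟨hE, hD⟩ := hS
  have hne := hD.1
  obtain ⟨hconn, hcne⟩ := hD.sideConnected_compl hE
  have hb := isoperimetricBounds hE hne hconn hcne hpent
  have hK := six_mul_eulerChar hE S
  rw [hD.2.2] at hK
  have hlr := E.lefts_add_rights S
  have h3 : ∀ f, E.exposedAt S f ≤ 3 * E.arcsAt S f := exposedAt_le_three_mul hE hexp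
  have hn3 : E.boundaryLength S ≤ 3 * E.rights S := by
    rw [← sum_exposedAt, ← sum_arcsAt, Finset.mul_sum]
    exact Finset.sum_le_sum fun f _ => h3 f
  have hp2 : E.numPentagons S ≤ 2 := by
    by_contra! h
    have := hb.of_three_le h
    omega
  have hp : E.numPentagons S = 2 := by omega
  have hcount : ∀ T : Set E.Face, (∀ f ∈ T, 1 ≤ E.arcsAt S f) → T.ncard ≤ E.rights S := by
    intro T hT
    rw [ncard_faces_eq_sum, ← sum_arcsAt]
    refine Finset.sum_le_sum fun f _ => ?_
    by_cases hf : f ∈ T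
    · simpa [hf] using hT f hf
    · simp [hf]
  have harc : ∀ f ∈ S, f ∉ E.deep S → 1 ≤ E.arcsAt S f := by
    intro f hf hd
    have h1 : E.exposedAt S f ≠ 0 := fun h => hd ((exposedAt_eq_zero_iff hf).1 h)
    have := h3 f
    omega
  have hss := deep_ssubset hE hne hcne
  have hdeep : E.deep S = ∅ := by
    by_contra hdn
    rw [← ne_eq, ← Set.nonempty_iff_ne_empty] at hdn
    have hring := boundaryLength_deep_add_le hE hexp
    have hdp := numPentagons_union (E := E) (A := E.deep S) (B := S \ E.deep S)
      Set.disjoint_sdiff_right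
    rw [Set.union_sdiff_cancel hss.1] at hdp
    have hdb := isoperimetricBounds hE hdn (sideConnected_compl_deep hconn)
      (hcne.mono (Set.compl_subset_compl.2 hss.1)) (by omega)
    obtain h0 | h1 | h2 : E.numPentagons (E.deep S) = 0 ∨ E.numPentagons (E.deep S) = 1 ∨
        E.numPentagons (E.deep S) = 2 := by omega
    · have := hdb.of_zero h0
      omega
    · rcases hdb.of_one h1 with h | ⟨g, hg⟩
      · omega
      -- The five neighbours of the pentagon `g` and the other pentagon all have exposed sides.
      · have hgS : g ∈ S := hss.1 (hg ▸ rfl)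
        have h5 : E.faceLength g = 5 := by
          by_contra h
          rw [hg, numPentagons_eq_zero_iff.2 (by simpa using h)] at h1
          omega
        obtain ⟨y, hy, hy5⟩ : ∃ y ∈ S \ E.deep S, E.faceLength y = 5 := by
          by_contra! h
          have := (numPentagons_eq_zero_iff (E := E) (T := S \ E.deep S)).2 h
          omega
        have hyg : y ≠ g := fun h => hy.2 (by rw [hg, h]; rfl)
        have hgy : g ∈ S \ {y} := ⟨hgS, fun h => hyg h.symm⟩
        have e1 := faceLength_le_exposedAt_add hE hgy
        have e2 : E.exposedAt (S \ {y}) g = 0 := by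
          rw [exposedAt_eq_zero_iff hgy]
          refine ⟨hgy, ?_⟩
          rintro d rfl
          refine ⟨(show E.faceOf d ∈ E.deep S from hg ▸ rfl).2 d rfl, fun h => ?_⟩
          exact hE.not_adj _ _ h5 hy5 ⟨d, rfl, h⟩
        have e3 := Set.ncard_sdiff_singleton_add_one hgy
        have e4 := Set.ncard_sdiff_singleton_add_one hy.1
        have e5 := hcount (S \ E.deep S) fun f hf => harc f hf.1 hf.2
        rw [hg] at e5
        have e6 := Set.ncard_sdiff_singleton_add_one hgS
        have := boundaryLength_singleton hE g
        omega
    · have := hdb.of_two h2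
      omega
  have harc : ∀ f ∈ S, 1 ≤ E.arcsAt S f := fun f hf => harc f hf (by simp [hdeep])
  have hsum : ∑ f, (3 * E.arcsAt S f - E.exposedAt S f) = E.rights S - 4 := by
    have : ∑ f, (3 * E.arcsAt S f - E.exposedAt S f) + ∑ f, E.exposedAt S f
        = 3 * ∑ f, E.arcsAt S f := by
      rw [← Finset.sum_add_distrib, Finset.mul_sum]
      exact Finset.sum_congr rfl fun f _ => Nat.sub_add_cancel (h3 f)
    rw [sum_exposedAt, sum_arcsAt] at this
    omega
  have hone : ∀ f ∈ S, E.arcsAt S f = 1 := by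
    intro f hf
    have h1 := harc f hf
    have h2 := Finset.single_le_sum (f := fun f => 3 * E.arcsAt S f - E.exposedAt S f)
      (fun _ _ => Nat.zero_le _) (Finset.mem_univ f)
    have h4 := exposedAt_add_arcsAt_le hE S f
    omega
  have hcard : S.ncard = E.rights S := by
    rw [ncard_faces_eq_sum, ← sum_arcsAt]
    refine Finset.sum_congr rfl fun f _ => ?_
    by_cases hf : f ∈ S
    · simp [hf, hone f hf]
    · have := leftsAt_add_arcsAt S f
      rw [exposedAt_of_notMem hf] at this
      simp [hf]
      omega
  refine ⟨hp, hone, ?_⟩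
  obtain h4 | h5 : E.rights S = 4 ∨ E.rights S = 5 := by omega
  · refine Or.inl ⟨by omega, fun f hf => ?_⟩
    have h1 := hone f hf
    have h2 := Finset.single_le_sum (f := fun f => 3 * E.arcsAt S f - E.exposedAt S f)
      (fun _ _ => Nat.zero_le _) (Finset.mem_univ f)
    have := h3 f
    omega
  · refine Or.inr ⟨by omega, ?_⟩
    rw [h5] at hsum
    obtain ⟨z, -, hz⟩ := Finset.exists_ne_zero_of_sum_ne_zero (by rw [hsum]; norm_num)
    have hzS : z ∈ S := by
      by_contra h
      have := leftsAt_add_arcsAt S z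
      rw [exposedAt_of_notMem h] at this
      omega
    have hz1 := hone z hzS
    rw [← Finset.add_sum_erase _ _ (Finset.mem_univ z)] at hsum
    refine ⟨z, hzS, by omega, fun f hf hfz => ?_⟩
    have h1 := hone f hf
    have h2 := Finset.single_le_sum (f := fun f => 3 * E.arcsAt S f - E.exposedAt S f)
      (fun _ _ => Nat.zero_le _) (Finset.mem_erase.2 ⟨hfz, Finset.mem_univ f⟩)
    have := h3 f
    omega

end Shape

end CombMap

/-! ### Recognizing a diagram from base sides of its polygons -/

lemma iterate_finRotate {α : Type*} (f : α → α) (x : α) (n : ℕ) (hx : f^[n] x = x) (i : Fin n) :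
    f (f^[i] x) = f^[finRotate n i] x := by
  obtain _ | n := n
  · exact i.elim0
  rw [← Function.iterate_succ_apply' f, coe_finRotate]
  split_ifs with h
  · subst h
    simpa using hx
  · rfl

namespace CombMap

section Recognition

open scoped Classical

variable {D : Type*} [Fintype D] {E : CombMap D} {S : Set E.Face}

/-- A diagram is isomorphic to a glued collection of polygons if base sides of its `2`-cells can be
chosen such that the prescribed sides are glued and the others are exposed. -/
lemma diagram_iso_ofList {k : ℕ} (len : Fin k → ℕ) (l : List ((ℕ × ℕ) × (ℕ × ℕ))) (b : ℕ → D)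
    (hlen : ∀ c : Fin k, E.faceLength (E.faceOf (b c)) = len c)
    (hb : Set.BijOn (fun c : Fin k => E.faceOf (b c)) Set.univ S)
    (hl : ∀ p ∈ l, E.edge (E.face^[p.1.2] (b p.1.1)) = E.face^[p.2.2] (b p.2.1))
    (hf : ∀ a : (PolygonGluing.ofList len l).Side, (∃ a', (PolygonGluing.ofList len l).glue a a') ∨
      E.faceOf (E.edge (E.face^[a.2] (b a.1))) ∉ S) :
    (E.diagram S).Iso (PolygonGluing.ofList len l) := by
  let φ : (PolygonGluing.ofList len l).Side → (E.diagram S).Side := fun a =>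
    ⟨E.face^[a.2] (b a.1), by rw [faceOf_iterate]; exact hb.mapsTo trivial⟩
  have hglue : ∀ a a', (PolygonGluing.ofList len l).glue a a' →
      E.edge (E.face^[a.2] (b a.1)) = E.face^[a'.2] (b a'.1) := by
    rintro a a' (h | h)
    · exact hl _ h
    · rw [← hl _ h, edge_edge_apply]
  have hφ : Function.Bijective φ := by
    constructor
    · rintro ⟨c, i⟩ ⟨c', i'⟩ h
      have h : E.face^[i] (b c) = E.face^[i'] (b c') := congrArg Subtype.val h
      have h1 : c = c' := hb.injOn trivial trivial (by
        simpa using congrArg E.faceOf h)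
      subst h1
      have := E.iterate_face_inj (by rw [hlen]; exact i.2) (by rw [hlen]; exact i'.2) h
      rw [Fin.ext this]
    · rintro ⟨d, hd⟩
      obtain ⟨c, -, hc⟩ := hb.surjOn hd
      obtain ⟨i, hi, rfl⟩ := E.exists_iterate_of_faceOf_eq hc.symm
      rw [hlen] at hi
      exact ⟨⟨c, i, hi⟩, rfl⟩
  let e := Equiv.ofBijective φ hφ
  refine ⟨e.symm, ?_, ?_⟩
  · intro a
    rw [Equiv.symm_apply_eq]
    obtain ⟨x, rfl⟩ := e.surjective a
    rw [Equiv.symm_apply_apply]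
    refine Subtype.ext ?_
    refine iterate_finRotate E.face (b x.1) (len x.1) ?_ x.2
    rw [← hlen, iterate_faceLength]
  · intro a a'
    obtain ⟨x, rfl⟩ := e.surjective a
    obtain ⟨x', rfl⟩ := e.surjective a'
    rw [Equiv.symm_apply_apply, Equiv.symm_apply_apply]
    constructor
    · intro h
      have h : E.edge (E.face^[x.2] (b x.1)) = E.face^[x'.2] (b x'.1) := h
      rcases hf x with ⟨y, hy⟩ | hx
      · have : y = x' := hφ.1 (Subtype.ext ((hglue x y hy).symm.trans h))
        rwa [← this]
      · rw [h, faceOf_iterate] at hx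
        exact absurd (hb.mapsTo trivial) hx
    · exact hglue x x'

lemma bijOn_of_ncard {k : ℕ} {F : Fin k → E.Face} (hinj : Function.Injective F)
    (hmem : ∀ c, F c ∈ S) (hcard : S.ncard = k) : Set.BijOn F Set.univ S := by
  refine ⟨fun c _ => hmem c, hinj.injOn, ?_⟩
  have : F '' Set.univ = S := by
    refine Set.eq_of_subset_of_ncard_le (by rintro _ ⟨c, -, rfl⟩; exact hmem c) ?_
    rw [Set.ncard_image_of_injective _ hinj, Set.ncard_univ, Nat.card_eq_fintype_card,
      Fintype.card_fin, hcard]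
  exact this.ge

lemma numPentagons_eq_sum_fin {D : Type*} [Finite D] {E : CombMap D} {S : Set E.Face}
    {k : ℕ} {F : Fin k → E.Face} (hF : Set.BijOn F Set.univ S) :
    E.numPentagons S = ∑ c, (decide (E.faceLength (F c) = 5)).toNat := by
  rw [← ncard_eq_sum, numPentagons, ← (hF.injOn.mono (Set.subset_univ _)).ncard_image]
  congr 1
  ext f
  constructor
  · rintro ⟨hf, h5⟩
    obtain ⟨c, -, rfl⟩ := hF.surjOn hf
    exact ⟨c, h5, rfl⟩
  · rintro ⟨c, h5, rfl⟩
    exact ⟨hF.mapsTo trivial, h5⟩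

/-! ### Base sides -/

lemma sides_ne (hE : E.IsSoccerTiling) (d : D) {i j : ℕ} (hi : i < 5) (hj : j < 5) (hij : i ≠ j) :
    E.faceOf (E.edge (E.face^[i] d)) ≠ E.faceOf (E.edge (E.face^[j] d)) := by
  intro h
  have := hE.hasSimplicialDual.2.1 _ _ (by simp) h
  refine hij (E.iterate_face_inj (d := d) ?_ ?_ this) <;>
    rcases hE.faceLength_eq (E.faceOf d) with h | h <;> omega

/-- The two `2`-cells that share consecutive sides with a third one share a side. -/
lemma faceAdj_of_consecutive (hE : E.IsSoccerTiling) (d : D) :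
    E.FaceAdj (E.faceOf (E.edge d)) (E.faceOf (E.edge (E.face d))) := by
  refine ⟨E.face.symm (E.edge d), by simp, ?_⟩
  rw [← E.face_edge_face hE.vertexDegree_eq, edge_edge_apply, faceOf_face]

lemma exists_base_pentagon {f : E.Face} (h5 : E.faceLength f = 5)
    (ha : E.exposedAt S f = 3) (hm : E.arcsAt S f = 1) :
    ∃ d, E.faceOf d = f ∧ E.exposed S d = false ∧ E.exposed S (E.face d) = false := by
  obtain ⟨d, rfl⟩ := E.exists_faceOf_eq f
  rw [exposedAt, sideSum_five h5] at ha
  rw [arcsAt, sideSum_five h5, faceLength_five h5] at hm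
  by_contra! hcon
  have k0 := hcon d rfl
  have k1 := hcon (E.face d) (by simp)
  have k2 := hcon (E.face (E.face d)) (by simp)
  have k3 := hcon (E.face (E.face (E.face d))) (by simp)
  have k4 := hcon (E.face (E.face (E.face (E.face d)))) (by simp)
  rw [faceLength_five h5] at k4
  revert ha hm k0 k1 k2 k3 k4
  cases E.exposed S d <;> cases E.exposed S (E.face d) <;>
    cases E.exposed S (E.face (E.face d)) <;> cases E.exposed S (E.face (E.face (E.face d))) <;>
    cases E.exposed S (E.face (E.face (E.face (E.face d)))) <;> simp

/-- In a hexagon with one arc of at most three exposed sides, the sides that follow this arc. -/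
lemma exists_base_hexagon {f : E.Face} (h6 : E.faceLength f = 6)
    (ha : E.exposedAt S f = 2 ∨ E.exposedAt S f = 3) (hm : E.arcsAt S f = 1) :
    ∃ d, E.faceOf d = f ∧ E.exposed S d = false ∧ E.exposed S (E.face d) = false ∧
      E.exposed S (E.face (E.face d)) = false ∧
      (E.exposedAt S f = 2 → E.exposed S (E.face (E.face (E.face d))) = false) := by
  obtain ⟨d, rfl⟩ := E.exists_faceOf_eq f
  by_contra! hcon
  have k0 := hcon d rfl
  have k1 := hcon (E.face d) (by simp)
  have k2 := hcon (E.face (E.face d)) (by simp)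
  have k3 := hcon (E.face (E.face (E.face d))) (by simp)
  have k4 := hcon (E.face (E.face (E.face (E.face d)))) (by simp)
  have k5 := hcon (E.face (E.face (E.face (E.face (E.face d))))) (by simp)
  simp only [faceLength_six h6] at k0 k1 k2 k3 k4 k5
  rw [arcsAt, sideSum_six h6, faceLength_six h6] at hm
  rw [exposedAt, sideSum_six h6] at ha k0 k1 k2 k3 k4 k5
  revert ha hm k0 k1 k2 k3 k4 k5
  cases E.exposed S d <;> cases E.exposed S (E.face d) <;>
    cases E.exposed S (E.face (E.face d)) <;> cases E.exposed S (E.face (E.face (E.face d))) <;>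
    cases E.exposed S (E.face (E.face (E.face (E.face d)))) <;>
    cases E.exposed S (E.face (E.face (E.face (E.face (E.face d))))) <;> simp

/-- The sides after the first two of a pentagon with three exposed sides. -/
lemma exposed_of_pentagon {d : D} (h5 : E.faceLength (E.faceOf d) = 5)
    (ha : E.exposedAt S (E.faceOf d) = 3) (h0 : E.exposed S d = false)
    (h1 : E.exposed S (E.face d) = false) {i : ℕ} (hi : 2 ≤ i) (hi' : i < 5) :
    E.faceOf (E.edge (E.face^[i] d)) ∉ S := by
  refine (E.exposed_eq_true.1 ?_).2
  rw [exposedAt, sideSum_five h5, h0, h1] at ha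
  revert ha
  interval_cases i <;> simp only [Function.iterate_succ_apply', Function.iterate_zero_apply] <;>
  cases E.exposed S (E.face (E.face d)) <;> cases E.exposed S (E.face (E.face (E.face d))) <;>
    cases E.exposed S (E.face (E.face (E.face (E.face d)))) <;> simp

/-- The sides after the first three of a hexagon with three exposed sides. -/
lemma exposed_of_hexagon {d : D} (h6 : E.faceLength (E.faceOf d) = 6)
    (ha : E.exposedAt S (E.faceOf d) = 3) (h0 : E.exposed S d = false)
    (h1 : E.exposed S (E.face d) = false) (h2 : E.exposed S (E.face (E.face d)) = false)
    {i : ℕ} (hi : 3 ≤ i) (hi' : i < 6) : E.faceOf (E.edge (E.face^[i] d)) ∉ S := by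
  refine (E.exposed_eq_true.1 ?_).2
  rw [exposedAt, sideSum_six h6, h0, h1, h2] at ha
  revert ha
  interval_cases i <;> simp only [Function.iterate_succ_apply', Function.iterate_zero_apply] <;>
  cases E.exposed S (E.face (E.face (E.face d))) <;>
    cases E.exposed S (E.face (E.face (E.face (E.face d)))) <;>
    cases E.exposed S (E.face (E.face (E.face (E.face (E.face d))))) <;> simp

/-- The sides after the first four of a hexagon with two exposed sides. -/
lemma exposed_of_hexagon' {d : D} (h6 : E.faceLength (E.faceOf d) = 6)
    (ha : E.exposedAt S (E.faceOf d) = 2) (h0 : E.exposed S d = false)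
    (h1 : E.exposed S (E.face d) = false) (h2 : E.exposed S (E.face (E.face d)) = false)
    (h3 : E.exposed S (E.face (E.face (E.face d))) = false)
    {i : ℕ} (hi : 4 ≤ i) (hi' : i < 6) : E.faceOf (E.edge (E.face^[i] d)) ∉ S := by
  refine (E.exposed_eq_true.1 ?_).2
  rw [exposedAt, sideSum_six h6, h0, h1, h2, h3] at ha
  revert ha
  interval_cases i <;> simp only [Function.iterate_succ_apply', Function.iterate_zero_apply] <;>
    cases E.exposed S (E.face (E.face (E.face (E.face d)))) <;>
    cases E.exposed S (E.face (E.face (E.face (E.face (E.face d))))) <;> simp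

end Recognition

end CombMap

/-! ### The two diagrams -/

namespace CombMap

section Diagrams

open scoped Classical

variable {D : Type*} [Fintype D] {E : CombMap D} {S : Set E.Face}

lemma diagram_iso_twelve (hE : E.IsSoccerTiling) (hp : E.numPentagons S = 2)
    (hm : ∀ f ∈ S, E.arcsAt S f = 1) (hcard : S.ncard = 4) (ha : ∀ f ∈ S, E.exposedAt S f = 3) :
    (E.diagram S).Iso diagramTwelve := by
  obtain ⟨h, hh, h5⟩ : ∃ h ∈ S, E.faceLength h ≠ 5 := by
    by_contra! hcon
    have := numPentagons_eq_ncard hcon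
    omega
  have h6 := (hE.faceLength_eq h).resolve_left h5
  obtain ⟨d, rfl, x0, x1, x2, -⟩ := exists_base_hexagon h6 (Or.inr (ha h hh)) (hm h hh)
  rw [E.exposed_eq_false (by simpa using hh)] at x0 x1 x2
  have c0 := E.face_edge_face hE.vertexDegree_eq d
  have c1 := E.face_edge_face hE.vertexDegree_eq (E.face d)
  let b : ℕ → D
    | 0 => d
    | 1 => E.face.symm (E.edge (E.face d))
    | 2 => E.face.symm (E.edge d)
    | _ => E.edge (E.face (E.face d))
  have n01 := hE.hasSimplicialDual.1 (E.face d)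
  have n02 := hE.hasSimplicialDual.1 d
  have n03 := hE.hasSimplicialDual.1 (E.face (E.face d))
  have n12 := sides_ne hE d (i := 1) (j := 0) (by norm_num) (by norm_num) (by norm_num)
  have n13 := sides_ne hE d (i := 1) (j := 2) (by norm_num) (by norm_num) (by norm_num)
  have n23 := sides_ne hE d (i := 0) (j := 2) (by norm_num) (by norm_num) (by norm_num)
  simp only [faceOf_face, Function.iterate_succ_apply', Function.iterate_zero_apply]
    at n01 n02 n03 n12 n13 n23
  have hb : Set.BijOn (fun c : Fin 4 => E.faceOf (b c)) Set.univ S := by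
    refine bijOn_of_ncard ?_ ?_ hcard
    · intro i j
      fin_cases i <;> fin_cases j <;>
        simp [b, n01, n02, n03, n12, n13, n23, n01.symm, n02.symm, n03.symm, n12.symm, n13.symm,
          n23.symm]
    · intro i
      fin_cases i <;> simpa [b]
  have hsum := numPentagons_eq_sum_fin hb
  rw [hp, Fin.sum_univ_four] at hsum
  simp only [Fin.val_zero, Fin.val_one, Fin.val_two, b, faceOf_face_symm] at hsum
  have l1 : E.faceLength (E.faceOf (E.edge (E.face d))) ≠ 5 := by
    intro h
    have h1 : E.faceLength (E.faceOf (E.edge d)) ≠ 5 := fun h' =>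
      hE.not_adj _ _ h' h (faceAdj_of_consecutive hE d)
    have h2 : E.faceLength (E.faceOf (E.edge (E.face (E.face d)))) ≠ 5 := fun h' =>
      hE.not_adj _ _ h h' (faceAdj_of_consecutive hE (E.face d))
    simp [h5, h, h1, h2] at hsum
  have l1' := (hE.faceLength_eq _).resolve_left l1
  have l2 : E.faceLength (E.faceOf (E.edge d)) = 5 := by
    by_contra h
    have := Bool.toNat_le (decide (E.faceLength (E.faceOf (E.edge (E.face (E.face d)))) = 5))
    simp [h5, l1, h] at hsum
    omega
  have l3 : E.faceLength (E.faceOf (E.edge (E.face (E.face d)))) = 5 := by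
    by_contra h
    simp [h5, l1, l2, h] at hsum
  have e1 : E.edge (E.face.symm (E.edge (E.face d))) = E.face (E.edge (E.face (E.face d))) := by
    rw [← c1, edge_edge_apply]
  have e2 : E.edge (E.face.symm (E.edge d)) = E.face (E.edge (E.face d)) := by
    rw [← c0, edge_edge_apply]
  have f0 : ∀ {i : ℕ}, 3 ≤ i → i < 6 → E.faceOf (E.edge (E.face^[i] d)) ∉ S :=
    exposed_of_hexagon h6 (ha _ hh) ((E.exposed_eq_false hh).2 x0)
      ((E.exposed_eq_false (by simpa)).2 x1) ((E.exposed_eq_false (by simpa)).2 x2)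
  have f1 : ∀ {i : ℕ}, 3 ≤ i → i < 6 → E.faceOf (E.edge (E.face^[i] (b 1))) ∉ S :=
    exposed_of_hexagon (by simpa [b]) (ha _ (by simpa [b]))
      ((E.exposed_eq_false (by simpa [b])).2 (by simpa [b, e1]))
      ((E.exposed_eq_false (by simpa [b])).2 (by simpa [b]))
      ((E.exposed_eq_false (by simpa [b])).2 (by simpa [b, c0]))
  have f2 : ∀ {i : ℕ}, 2 ≤ i → i < 5 → E.faceOf (E.edge (E.face^[i] (b 2))) ∉ S :=
    exposed_of_pentagon (by simpa [b]) (ha _ (by simpa [b]))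
      ((E.exposed_eq_false (by simpa [b])).2 (by simpa [b, e2]))
      ((E.exposed_eq_false (by simpa [b])).2 (by simpa [b]))
  have f3 : ∀ {i : ℕ}, 2 ≤ i → i < 5 → E.faceOf (E.edge (E.face^[i] (b 3))) ∉ S :=
    exposed_of_pentagon (by simpa [b]) (ha _ (by simpa [b]))
      ((E.exposed_eq_false (by simpa [b])).2 (by simpa [b]))
      ((E.exposed_eq_false (by simpa [b])).2 (by simpa [b, c1]))
  refine diagram_iso_ofList _ _ b ?_ hb ?_ ?_
  · intro c
    fin_cases c <;> simpa [b]
  · simp [b, c0, e1]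
  · intro a
    have hfree : ∀ a : diagramTwelve.Side, (∃ a', diagramTwelve.glue a a') ∨
        ((a.1 : ℕ) < 2 ∧ 3 ≤ (a.2 : ℕ)) ∨ (2 ≤ (a.1 : ℕ) ∧ 2 ≤ (a.2 : ℕ)) := by
      unfold diagramTwelve PolygonGluing.ofList
      decide
    refine (hfree a).imp id ?_
    obtain ⟨c, i, hi⟩ := a
    fin_cases c
    · exact fun h => f0 (by simpa using h) hi
    · exact fun h => f1 (by simpa using h) hi
    · exact fun h => f2 (by simpa using h) hi
    · exact fun h => f3 (by simpa using h) hi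

end Diagrams
end CombMap

namespace CombMap

section Diagrams

open scoped Classical

variable {D : Type*} [Fintype D] {E : CombMap D} {S : Set E.Face}

lemma diagram_iso_fourteen (hE : E.IsSoccerTiling) (hp : E.numPentagons S = 2)
    (hm : ∀ f ∈ S, E.arcsAt S f = 1) (hcard : S.ncard = 5) {z : E.Face} (hz : z ∈ S)
    (hz2 : E.exposedAt S z = 2) (ha : ∀ f ∈ S, f ≠ z → E.exposedAt S f = 3)
    (h6 : E.faceLength z = 6) : (E.diagram S).Iso diagramFourteen := by
  obtain ⟨d, rfl, x0, x1, x2, x3⟩ := exists_base_hexagon h6 (Or.inl hz2) (hm z hz)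
  replace x3 := x3 hz2
  rw [E.exposed_eq_false (by simpa using hz)] at x0 x1 x2 x3
  have c0 := E.face_edge_face hE.vertexDegree_eq d
  have c1 := E.face_edge_face hE.vertexDegree_eq (E.face d)
  have c2 := E.face_edge_face hE.vertexDegree_eq (E.face (E.face d))
  let b : ℕ → D
    | 0 => d
    | 1 => E.face.symm (E.edge d)
    | 2 => E.face.symm (E.edge (E.face d))
    | 3 => E.face.symm (E.edge (E.face (E.face d)))
    | _ => E.edge (E.face (E.face (E.face d)))
  have n01 := hE.hasSimplicialDual.1 d
  have n02 := hE.hasSimplicialDual.1 (E.face d)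
  have n03 := hE.hasSimplicialDual.1 (E.face (E.face d))
  have n04 := hE.hasSimplicialDual.1 (E.face (E.face (E.face d)))
  have n12 := sides_ne hE d (i := 0) (j := 1) (by norm_num) (by norm_num) (by norm_num)
  have n13 := sides_ne hE d (i := 0) (j := 2) (by norm_num) (by norm_num) (by norm_num)
  have n14 := sides_ne hE d (i := 0) (j := 3) (by norm_num) (by norm_num) (by norm_num)
  have n23 := sides_ne hE d (i := 1) (j := 2) (by norm_num) (by norm_num) (by norm_num)
  have n24 := sides_ne hE d (i := 1) (j := 3) (by norm_num) (by norm_num) (by norm_num)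
  have n34 := sides_ne hE d (i := 2) (j := 3) (by norm_num) (by norm_num) (by norm_num)
  simp only [faceOf_face, Function.iterate_succ_apply', Function.iterate_zero_apply]
    at n01 n02 n03 n04 n12 n13 n14 n23 n24 n34
  have hb : Set.BijOn (fun c : Fin 5 => E.faceOf (b c)) Set.univ S := by
    refine bijOn_of_ncard ?_ ?_ hcard
    · intro i j
      fin_cases i <;> fin_cases j <;>
        simp [b, n01, n02, n03, n04, n12, n13, n14, n23, n24, n34, n01.symm, n02.symm, n03.symm,
          n04.symm, n12.symm, n13.symm, n14.symm, n23.symm, n24.symm, n34.symm]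
    · intro i
      fin_cases i <;> simpa [b]
  have e1 : E.edge (E.face.symm (E.edge d)) = E.face (E.edge (E.face d)) := by
    rw [← c0, edge_edge_apply]
  have e2 : E.edge (E.face.symm (E.edge (E.face d))) = E.face (E.edge (E.face (E.face d))) := by
    rw [← c1, edge_edge_apply]
  have e3 : E.edge (E.face.symm (E.edge (E.face (E.face d))))
      = E.face (E.edge (E.face (E.face (E.face d)))) := by
    rw [← c2, edge_edge_apply]
  -- The second and the third neighbour share three consecutive sides with others, so they cannot be
  -- pentagons with three exposed sides.
  have hhex : ∀ y, E.faceOf y ∈ S → E.faceOf y ≠ E.faceOf d → E.exposed S y = false →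
      E.exposed S (E.face y) = false → E.exposed S (E.face (E.face y)) = false →
      E.faceLength (E.faceOf y) ≠ 5 := by
    intro y hy hyd y0 y1 y2 h5
    have h3 := ha _ hy hyd
    have b3 := Bool.toNat_le (E.exposed S (E.face (E.face (E.face y))))
    have b4 := Bool.toNat_le (E.exposed S (E.face (E.face (E.face (E.face y)))))
    rw [exposedAt, sideSum_five h5, y0, y1, y2] at h3
    simp only [Bool.toNat_false] at h3
    omega
  have y20 : E.exposed S (b 2) = false :=
    (E.exposed_eq_false (by simpa [b])).2 (by simpa [b, e2])
  have y21 : E.exposed S (E.face (b 2)) = false :=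
    (E.exposed_eq_false (by simpa [b])).2 (by simpa [b])
  have y22 : E.exposed S (E.face (E.face (b 2))) = false :=
    (E.exposed_eq_false (by simpa [b])).2 (by simpa [b, c0])
  have y30 : E.exposed S (b 3) = false :=
    (E.exposed_eq_false (by simpa [b])).2 (by simpa [b, e3])
  have y31 : E.exposed S (E.face (b 3)) = false :=
    (E.exposed_eq_false (by simpa [b])).2 (by simpa [b])
  have y32 : E.exposed S (E.face (E.face (b 3))) = false :=
    (E.exposed_eq_false (by simpa [b])).2 (by simpa [b, c1])
  have l2 := hhex (b 2) (by simpa [b]) (by simpa [b] using n02.symm) y20 y21 y22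
  have l3 := hhex (b 3) (by simpa [b]) (by simpa [b] using n03.symm) y30 y31 y32
  have l2' := (hE.faceLength_eq _).resolve_left l2
  have l3' := (hE.faceLength_eq _).resolve_left l3
  have hsum := numPentagons_eq_sum_fin hb
  rw [hp, Fin.sum_univ_five] at hsum
  have l1 : E.faceLength (E.faceOf (b 1)) = 5 := by
    by_contra h
    have := Bool.toNat_le (decide (E.faceLength (E.faceOf (b 4)) = 5))
    simp [show b 0 = d from rfl, h6, l2, l3, h] at hsum
    omega
  have l4 : E.faceLength (E.faceOf (b 4)) = 5 := by
    by_contra h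
    simp [show b 0 = d from rfl, h6, l1, l2, l3, h] at hsum
  have f0 : ∀ {i : ℕ}, 4 ≤ i → i < 6 → E.faceOf (E.edge (E.face^[i] d)) ∉ S :=
    exposed_of_hexagon' h6 hz2 ((E.exposed_eq_false hz).2 x0)
      ((E.exposed_eq_false (by simpa)).2 x1) ((E.exposed_eq_false (by simpa)).2 x2)
      ((E.exposed_eq_false (by simpa)).2 x3)
  have f1 : ∀ {i : ℕ}, 2 ≤ i → i < 5 → E.faceOf (E.edge (E.face^[i] (b 1))) ∉ S :=
    exposed_of_pentagon l1 (ha _ (by simpa [b]) (by simpa [b] using n01.symm))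
      ((E.exposed_eq_false (by simpa [b])).2 (by simpa [b, e1]))
      ((E.exposed_eq_false (by simpa [b])).2 (by simpa [b]))
  have f2 : ∀ {i : ℕ}, 3 ≤ i → i < 6 → E.faceOf (E.edge (E.face^[i] (b 2))) ∉ S :=
    exposed_of_hexagon l2' (ha _ (by simpa [b]) (by simpa [b] using n02.symm)) y20 y21 y22
  have f3 : ∀ {i : ℕ}, 3 ≤ i → i < 6 → E.faceOf (E.edge (E.face^[i] (b 3))) ∉ S :=
    exposed_of_hexagon l3' (ha _ (by simpa [b]) (by simpa [b] using n03.symm)) y30 y31 y32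
  have f4 : ∀ {i : ℕ}, 2 ≤ i → i < 5 → E.faceOf (E.edge (E.face^[i] (b 4))) ∉ S :=
    exposed_of_pentagon l4 (ha _ (by simpa [b]) (by simpa [b] using n04.symm))
      ((E.exposed_eq_false (by simpa [b])).2 (by simpa [b]))
      ((E.exposed_eq_false (by simpa [b])).2 (by simpa [b, c2]))
  refine diagram_iso_ofList _ _ b ?_ hb ?_ ?_
  · intro c
    fin_cases c
    exacts [h6, l1, l2', l3', l4]
  · simp [b, e1, e2, e3]
  · intro a
    have hfree : ∀ a : diagramFourteen.Side, (∃ a', diagramFourteen.glue a a') ∨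
        ((a.1 : ℕ) = 0 ∧ 4 ≤ (a.2 : ℕ)) ∨ ((a.1 : ℕ) = 1 ∧ 2 ≤ (a.2 : ℕ)) ∨
        ((a.1 : ℕ) = 2 ∧ 3 ≤ (a.2 : ℕ)) ∨ ((a.1 : ℕ) = 3 ∧ 3 ≤ (a.2 : ℕ)) ∨
        ((a.1 : ℕ) = 4 ∧ 2 ≤ (a.2 : ℕ)) := by
      unfold diagramFourteen PolygonGluing.ofList
      decide
    refine (hfree a).imp id ?_
    obtain ⟨c, i, hi⟩ := a
    fin_cases c
    · exact fun h => f0 (by simpa using h) hi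
    · exact fun h => f1 (by simpa using h) hi
    · exact fun h => f2 (by simpa using h) hi
    · exact fun h => f3 (by simpa using h) hi
    · exact fun h => f4 (by simpa using h) hi

/-- In a diagram with five `2`-cells, the one with two exposed sides is a hexagon. Otherwise it is a
pentagon that shares sides with all three hexagons; the other pentagon shares sides with two of
them, and one of these two shares sides with all other `2`-cells, which leaves only two exposed
sides. -/
lemma faceLength_eq_six (hE : E.IsSoccerTiling) (hp : E.numPentagons S = 2)
    (hm : ∀ f ∈ S, E.arcsAt S f = 1) (hcard : S.ncard = 5) {z : E.Face} (hz : z ∈ S)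
    (hz2 : E.exposedAt S z = 2) (ha : ∀ f ∈ S, f ≠ z → E.exposedAt S f = 3) :
    E.faceLength z = 6 := by
  refine (hE.faceLength_eq z).resolve_left fun hz5 => ?_
  have hnb := fun f (hf : f ∈ S) => faceLength_eq_exposedAt_add hE hf
  have hirr : ∀ f, ¬ E.FaceAdj f f := by
    rintro f ⟨d, rfl, h⟩
    exact hE.hasSimplicialDual.1 d h.symm
  -- The other pentagon `y` and its neighbours `a`, `b`.
  obtain ⟨y, ⟨hy, hy5⟩, hyz⟩ : ∃ y ∈ {f | f ∈ S ∧ E.faceLength f = 5}, y ≠ z :=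
    Set.exists_ne_of_one_lt_ncard (by rw [← numPentagons, hp]; norm_num) z
  have hpent : ∀ f ∈ S, E.faceLength f = 5 → f = y ∨ f = z := by
    intro f hf h5
    have : ({y, z} : Set E.Face) = {f | f ∈ S ∧ E.faceLength f = 5} := by
      refine Set.eq_of_subset_of_ncard_le ?_ ?_
      · rintro g (rfl | rfl)
        exacts [⟨hy, hy5⟩, ⟨hz, hz5⟩]
      · rw [Set.ncard_pair hyz, ← numPentagons, hp]
    have h : f ∈ ({y, z} : Set E.Face) := this ▸ ⟨hf, h5⟩
    simpa using h
  obtain ⟨d, rfl, x0, x1⟩ := exists_base_pentagon hy5 (ha y hy hyz) (hm y hy)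
  rw [E.exposed_eq_false (by simpa using hy)] at x0 x1
  obtain ⟨a, ea⟩ : ∃ a, a = E.faceOf (E.edge d) := ⟨_, rfl⟩
  obtain ⟨b, eb⟩ : ∃ b, b = E.faceOf (E.edge (E.face d)) := ⟨_, rfl⟩
  have hab : E.FaceAdj a b := ea ▸ eb ▸ faceAdj_of_consecutive hE d
  have hya : E.FaceAdj (E.faceOf d) a := ⟨d, rfl, ea.symm⟩
  have hyb : E.FaceAdj (E.faceOf d) b := ⟨E.face d, by simp, eb.symm⟩
  rw [← ea] at x0
  rw [← eb] at x1
  clear ea eb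
  generalize E.faceOf d = y at *
  have hne : ∀ {f g}, E.FaceAdj f g → f ≠ g := fun h h' => hirr _ (h' ▸ h)
  have a5 : E.faceLength a ≠ 5 := fun h => hE.not_adj _ _ hy5 h hya
  have b5 : E.faceLength b ≠ 5 := fun h => hE.not_adj _ _ hy5 h hyb
  have haz : a ≠ z := fun h => a5 (h ▸ hz5)
  have hbz : b ≠ z := fun h => b5 (h ▸ hz5)
  have hfour : ({y, z, a, b} : Set E.Face).ncard = 4 := by
    rw [Set.ncard_insert_of_notMem, Set.ncard_insert_of_notMem, Set.ncard_pair (hne hab)]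
    · simp [haz.symm, hbz.symm]
    · simp [hyz, hne hya, hne hyb]
  -- The third hexagon `c`.
  obtain ⟨c, hc, hc'⟩ := Set.exists_mem_notMem_of_ncard_lt_ncard (s := {y, z, a, b}) (t := S)
    (by omega)
  simp only [Set.mem_insert_iff, Set.mem_singleton_iff, not_or] at hc'
  obtain ⟨hcy, hcz, hca, hcb⟩ := hc'
  have hSall : ({c, y, z, a, b} : Set E.Face) = S := by
    refine Set.eq_of_subset_of_ncard_le ?_ ?_
    · rintro f (rfl | rfl | rfl | rfl | rfl) <;> assumption
    · rw [Set.ncard_insert_of_notMem (by simp [hcy, hcz, hca, hcb]), hfour, hcard]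
  have a6 := (hE.faceLength_eq a).resolve_left a5
  have c6 := (hE.faceLength_eq c).resolve_left fun h => by
    rcases hpent c hc h with h | h
    exacts [hcy h, hcz h]
  have hzc : ({a, b, c} : Set E.Face) = {g | g ∈ S ∧ E.FaceAdj z g} := by
    symm
    refine Set.eq_of_subset_of_ncard_le ?_ ?_
    · rintro g ⟨hg, hzg⟩
      rw [← hSall] at hg
      rcases hg with rfl | rfl | rfl | rfl | rfl
      · simp
      · exact absurd hzg (hE.not_adj _ _ hz5 hy5)
      · exact absurd hzg (hirr _)
      · simp
      · simp
    · have := hnb z hz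
      have h3 : ({a, b, c} : Set E.Face).ncard = 3 := by
        rw [Set.ncard_insert_of_notMem (by simp [hne hab, Ne.symm hca]),
          Set.ncard_pair (Ne.symm hcb)]
      omega
  have hyab : ({a, b} : Set E.Face) = {g | g ∈ S ∧ E.FaceAdj y g} := by
    refine Set.eq_of_subset_of_ncard_le ?_ ?_
    · rintro g (rfl | rfl)
      exacts [⟨x0, hya⟩, ⟨x1, hyb⟩]
    · have := hnb y hy
      have := ha y hy hyz
      rw [Set.ncard_pair (hne hab)]
      omega
  have hcn : ({a, b, z} : Set E.Face) = {g | g ∈ S ∧ E.FaceAdj c g} := by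
    symm
    refine Set.eq_of_subset_of_ncard_le ?_ ?_
    · rintro g ⟨hg, hcg⟩
      rw [← hSall] at hg
      rcases hg with rfl | rfl | rfl | rfl | rfl
      · exact absurd hcg (hirr _)
      · have : c ∈ ({a, b} : Set E.Face) := hyab ▸ ⟨hc, E.faceAdj_symm hcg⟩
        rcases this with h | h
        exacts [absurd h hca, absurd h hcb]
      · simp
      · simp
      · simp
    · have := hnb c hc
      have := ha c hc hcz
      have h3 : ({a, b, z} : Set E.Face).ncard = 3 := by
        rw [Set.ncard_insert_of_notMem (by simp [hne hab, haz]), Set.ncard_pair hbz]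
      omega
  have hza : E.FaceAdj z a := (show a ∈ {g | g ∈ S ∧ E.FaceAdj z g} from hzc ▸ by simp).2
  have hca' : E.FaceAdj c a := (show a ∈ {g | g ∈ S ∧ E.FaceAdj c g} from hcn ▸ by simp).2
  have hsub : ({c, y, z, b} : Set E.Face) ⊆ {g | g ∈ S ∧ E.FaceAdj a g} := by
    rintro g (rfl | rfl | rfl | rfl)
    exacts [⟨hc, E.faceAdj_symm hca'⟩, ⟨hy, E.faceAdj_symm hya⟩, ⟨hz, E.faceAdj_symm hza⟩,
      ⟨x1, hab⟩]
  have h4 : ({c, y, z, b} : Set E.Face).ncard = 4 := by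
    rw [Set.ncard_insert_of_notMem, Set.ncard_insert_of_notMem, Set.ncard_pair hbz.symm]
    · simp [hyz, hne hyb]
    · simp [hcy, hcz, hcb]
  have := Set.ncard_le_ncard hsub
  have := hnb a x0
  have := ha a x0 haz
  omega

end Diagrams

end CombMap

theorem mainTheorem2 {D : Type*} [Finite D] (E : CombMap D) (S : Set E.Face)
    (hS : E.IsSoccerDiagram S) (hlen : E.boundaryLength S ≤ 14) (hpent : E.numPentagons S ≤ 6)
    (hexp : ¬ E.HasExposedPath S 4) :
    (E.diagram S).Iso diagramTwelve ∨ (E.diagram S).Iso diagramFourteen := by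
  have := Fintype.ofFinite D
  obtain ⟨hp, hm, ⟨hcard, ha⟩ | ⟨hcard, z, hz, hz2, ha⟩⟩ :=
    CombMap.shape hS hlen hpent (CombMap.noFourExposed_of_not_hasExposedPath hexp)
  · exact Or.inl (CombMap.diagram_iso_twelve hS.1 hp hm hcard ha)
  · exact Or.inr (CombMap.diagram_iso_fourteen hS.1 hp hm hcard hz hz2 ha
      (CombMap.faceLength_eq_six hS.1 hp hm hcard hz hz2 ha))
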